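/- \textbf{Theorem.} Let $L$ be a finite-dimensional solvable restricted Lie algebra, with $p$-map $x\mapsto x^{[p]}$, over an algebraically closed field $\mathbb{F}$ of prime characteristic $p$, and let $\chi$ be any linear form on $L$. An $L$-module $M$ is said to have $p$-character $\chi$ if $x^p\cdot m-x^{[p]}\cdot m=\chi(x)^p\,m$ for all $x\in L$ and $m\in M$, where $x^p\cdot m$ denotes the $p$-fold action of $x$ on $m$. A torus of $L$ is an abelian subalgebra $T$ of $L$ that is closed under the $p$-map and all of whose elements $x$ are semisimple, i.e. $x$ lies in the linear span of the iterates $x^{[p]^i}$ with $i\ge 1$. Let $$\mathrm{MT}(L):=\max\{\dim_{\mathbb{F}}T\mid T\text{ is a torus of }L\}.$$ Then the number of isomorphism classes of irreducible $L$-modules with $p$-character $\chi$ is finite and at most $p^{\mathrm{MT}(L)}$. -/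

import Mathlib

universe u v w

open scoped TensorProduct

noncomputable section

/-- The elements `s_i(x, y)` of a Lie algebra `L` over a field `F` that occur in Jacobson's formula.
For `1 ≤ i ≤ p - 1`, where `p` is the characteristic of `F`, they are determined by the identity
`(ad (X ⊗ x + 1 ⊗ y)) ^ (p - 1) (1 ⊗ x) = ∑ i, X ^ (i - 1) ⊗ (i • s_i(x, y))` in the
Lie algebra `F[X] ⊗ L` over `F[X]`. -/
def jacobsonTerm (F : Type u) {L : Type v} [Field F] [LieRing L] [LieAlgebra F L]
    (p i : ℕ) (x y : L) : L :=
  (i : F)⁻¹ •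
    TensorProduct.lid F L
      (LinearMap.rTensor L (Polynomial.lcoeff F (i - 1))
        (((LieAlgebra.ad (Polynomial F) (Polynomial F ⊗[F] L)
          ((Polynomial.X : Polynomial F) ⊗ₜ[F] x + (1 : Polynomial F) ⊗ₜ[F] y)) ^ (p - 1))
            ((1 : Polynomial F) ⊗ₜ[F] x)))

/-- A restricted Lie algebra over a field `F` of characteristic `p`: a Lie algebra together with a
`p`-map `x ↦ x^[p]`. -/
class RestrictedLieAlgebra (p : ℕ) (F : Type u) (L : Type v) [Field F] [LieRing L]
    [LieAlgebra F L] where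
  /-- The `p`-map. -/
  pMap : L → L
  ad_pMap : ∀ x : L, LieAlgebra.ad F L (pMap x) = LieAlgebra.ad F L x ^ p
  pMap_smul : ∀ (a : F) (x : L), pMap (a • x) = a ^ p • pMap x
  pMap_add : ∀ x y : L,
    pMap (x + y) = pMap x + pMap y + ∑ i ∈ Finset.Icc 1 (p - 1), jacobsonTerm F p i x y

namespace RestrictedLieAlgebra

section Tori

variable (p : ℕ) (F : Type u) {L : Type v} [Field F] [LieRing L] [LieAlgebra F L]
  [RestrictedLieAlgebra p F L]

/-- An element `x` is semisimple if it lies in the `p`-subalgebra generated by `x^[p]`, i.e.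
in the linear span of the iterates `x^[p]^i`, `i ≥ 1`. -/
def IsSemisimpleElement (x : L) : Prop :=
  x ∈ Submodule.span F (Set.range fun i : ℕ => (pMap p F : L → L)^[i + 1] x)

/-- A torus is an abelian `p`-subalgebra consisting of semisimple elements. -/
structure IsTorus (T : LieSubalgebra F L) : Prop where
  pMap_mem : ∀ x ∈ T, pMap p F x ∈ T
  abelian : ∀ x ∈ T, ∀ y ∈ T, ⁅x, y⁆ = 0
  semisimple : ∀ x ∈ T, IsSemisimpleElement p F x

variable (L) in
/-- `MT(L)`, the largest dimension of a torus of `L` (meaningful for finite-dimensional `L`). -/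
def maxTorusDim : ℕ :=
  sSup {d : ℕ | ∃ T : LieSubalgebra F L, IsTorus p F T ∧ Module.finrank F T = d}

end Tori

section Modules

variable (p : ℕ) {F : Type u} {L : Type v} [Field F] [LieRing L] [LieAlgebra F L]
  [RestrictedLieAlgebra p F L]

/-- The `L`-module `M` has `p`-character `χ`: `x ^ p - x^[p]` acts on `M` as the scalar `χ(x) ^ p`,
for every `x` in `L`. -/
def HasPCharacter (χ : Module.Dual F L) (M : Type w) [AddCommGroup M] [Module F M]
    [LieRingModule L M] [LieModule F L M] : Prop :=
  ∀ x : L, LieModule.toEnd F L M x ^ p - LieModule.toEnd F L M (pMap p F x) =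
    χ x ^ p • (1 : Module.End F M)

/-- The irreducible `L`-modules (in a given universe) with `p`-character `χ`. -/
structure IrreducibleModule (χ : Module.Dual F L) where
  /-- The underlying type of the module. -/
  carrier : Type w
  [addCommGroup : AddCommGroup carrier]
  [module : Module F carrier]
  [lieRingModule : LieRingModule L carrier]
  [lieModule : LieModule F L carrier]
  irreducible : LieModule.IsIrreducible F L carrier
  hasPCharacter : HasPCharacter p χ carrier

attribute [instance] IrreducibleModule.addCommGroup IrreducibleModule.module
  IrreducibleModule.lieRingModule IrreducibleModule.lieModule

/-- Isomorphism of irreducible `L`-modules with `p`-character `χ`. -/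
def IrreducibleModule.isoSetoid (χ : Module.Dual F L) :
    Setoid (IrreducibleModule.{u, v, w} p χ) where
  r M N := Nonempty (M.carrier ≃ₗ⁅F, L⁆ N.carrier)
  iseqv :=
    { refl := fun _ => ⟨LieModuleEquiv.refl⟩
      symm := fun ⟨e⟩ => ⟨e.symm⟩
      trans := fun ⟨e⟩ ⟨f⟩ => ⟨e.trans f⟩ }

/-- `Irr(L, χ)`, the isomorphism classes of irreducible `L`-modules with `p`-character `χ`. -/
def Irr (χ : Module.Dual F L) : Type (max u v (w + 1)) :=
  Quotient (IrreducibleModule.isoSetoid.{u, v, w} p χ)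

end Modules

end RestrictedLieAlgebra

end

/-!
The proof is by induction on `dim L`, descending to a restricted subalgebra of codimension one; no
enveloping algebra is needed. For all `χ` it bounds the number of irreducible modules with
`p`-character `χ` by `p ^ dim T` for some torus `T` of `L`.

A nonzero solvable `L` has a proper ideal that contains `[L, L]` and is closed under the `p`-map
(`exists_proper_pMap_closed`). Modulo `[L, L]` the `p`-map is `p`-semilinear, and such maps have
eigenvectors over an algebraically closed field (`exists_eigenvector_of_semilinear`). Hence
`L = H + F x`, where `H` is a restricted subalgebra that contains `[L, L]`, and `x^[p] - c x` lies
in `H` for some scalar `c` (`exists_codim_one`).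

Let `M` and `M'` be irreducible `L`-modules with `p`-character `χ` that contain the same irreducible
`H`-module `V`. As `H` is an ideal, all `H`-composition factors of `M` are isomorphic to `V`. So `V`
is also a quotient of `M` (`exists_restrict_hom`), and `Hom_H(M, M')` is not zero. On this space
`x` has an eigenvector, for an eigenvalue `r` (`exists_isTwistedHom`). It is an isomorphism from a
twist of `M` by a character of `L / H` onto `M'` (`IsTwistedHom.bijective`), and comparison of the
actions of `x ^ p` gives `r ^ p = c * r` (`IsTwistedHom.pow_eq`). Therefore the isomorphism classes
over `L` embed into the product of those over `H` and the set of solutions of this equation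
(`exists_injective_irr`).

If `c = 0`, there is one solution, and a torus of `H` serves for `L`. If `c ≠ 0`, there are at most
`p` solutions, and a torus `T` of `H` can be enlarged (`IsTorus.exists_finrank_lt`): some element of
`x + H` centralizes `T`, a high iterate of it under the `p`-map is semisimple and not in `H`, and
together with `T` it generates a larger torus.
-/

/-! ### Jacobson's terms and the `p`-map -/

namespace RestrictedLieAlgebra

section Jacobson

variable {F : Type u} [Field F] {L : Type v} [LieRing L] [LieAlgebra F L]

/-- Extension of scalars along `F → F[X]` turns a homomorphism of Lie algebras into a map that
intertwines the adjoint actions. -/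
theorem lTensor_ad {H : Type*} [LieRing H] [LieAlgebra F H] (f : H →ₗ⁅F⁆ L)
    (a b : Polynomial F ⊗[F] H) :
    LinearMap.lTensor (Polynomial F) (f : H →ₗ[F] L)
        (LieAlgebra.ad (Polynomial F) (Polynomial F ⊗[F] H) a b) =
      LieAlgebra.ad (Polynomial F) (Polynomial F ⊗[F] L)
        (LinearMap.lTensor (Polynomial F) (f : H →ₗ[F] L) a)
        (LinearMap.lTensor (Polynomial F) (f : H →ₗ[F] L) b) := by
  induction a with
  | zero => simp
  | add a₁ a₂ h₁ h₂ => simp only [LinearMap.add_apply, map_add, h₁, h₂]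
  | tmul r x =>
    induction b with
    | zero => simp
    | add b₁ b₂ h₁ h₂ => simp only [map_add, h₁, h₂]
    | tmul s y => simp [LieAlgebra.ad_apply, LieAlgebra.ExtendScalars.bracket_tmul]

/-- Coefficient extraction `F[X] ⊗ V → V` is natural in `V`. -/
theorem lid_rTensor_lTensor {V W : Type*} [AddCommGroup V] [Module F V] [AddCommGroup W]
    [Module F W] (g : V →ₗ[F] W) (c : Polynomial F →ₗ[F] F) (t : Polynomial F ⊗[F] V) :
    g (TensorProduct.lid F V (LinearMap.rTensor V c t)) =
      TensorProduct.lid F W (LinearMap.rTensor W c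
        (LinearMap.lTensor (Polynomial F) g t)) := by
  induction t with
  | zero => simp
  | add a b ha hb => simp only [map_add, ha, hb]
  | tmul r x => simp

theorem map_jacobsonTerm {H : Type*} [LieRing H] [LieAlgebra F H] (f : H →ₗ⁅F⁆ L) (p i : ℕ)
    (x y : H) : f (jacobsonTerm F p i x y) = jacobsonTerm F p i (f x) (f y) := by
  have key : ∀ (k : ℕ) (a b : Polynomial F ⊗[F] H),
      LinearMap.lTensor (Polynomial F) (f : H →ₗ[F] L)
        ((LieAlgebra.ad (Polynomial F) (Polynomial F ⊗[F] H) a ^ k) b) =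
      (LieAlgebra.ad (Polynomial F) (Polynomial F ⊗[F] L)
        (LinearMap.lTensor (Polynomial F) (f : H →ₗ[F] L) a) ^ k)
        (LinearMap.lTensor (Polynomial F) (f : H →ₗ[F] L) b) := by
    intro k a b
    induction k with
    | zero => simp
    | succ k ih =>
      rw [pow_succ', pow_succ', Module.End.mul_apply, Module.End.mul_apply, lTensor_ad, ih]
  unfold jacobsonTerm
  rw [map_smul]
  congr 1
  have := lid_rTensor_lTensor (f : H →ₗ[F] L) (Polynomial.lcoeff F (i - 1))
    ((LieAlgebra.ad (Polynomial F) (Polynomial F ⊗[F] H)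
      ((Polynomial.X : Polynomial F) ⊗ₜ[F] x + (1 : Polynomial F) ⊗ₜ[F] y) ^ (p - 1))
        ((1 : Polynomial F) ⊗ₜ[F] x))
  rw [key] at this
  simpa using this

/-- The terms `s_i(x, y)` are sums of brackets. -/
theorem jacobsonTerm_mem {p : ℕ} (hp : 2 ≤ p) (i : ℕ) (x y : L) (K : Submodule F L)
    (hK : ∀ a b : L, ⁅a, b⁆ ∈ K) : jacobsonTerm F p i x y ∈ K := by
  have key : ∀ a b : Polynomial F ⊗[F] L, LinearMap.lTensor (Polynomial F) K.mkQ
      (LieAlgebra.ad (Polynomial F) (Polynomial F ⊗[F] L) a b) = 0 := by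
    intro a b
    induction a with
    | zero => simp
    | add a₁ a₂ h₁ h₂ => simp only [LinearMap.add_apply, map_add, h₁, h₂, add_zero]
    | tmul r x =>
      induction b with
      | zero => simp
      | add b₁ b₂ h₁ h₂ => simp only [map_add, h₁, h₂, add_zero]
      | tmul s y =>
        rw [LieAlgebra.ad_apply, LieAlgebra.ExtendScalars.bracket_tmul, LinearMap.lTensor_tmul,
          Submodule.mkQ_apply, (Submodule.Quotient.mk_eq_zero K).2 (hK x y),
          TensorProduct.tmul_zero]
  obtain ⟨q, rfl⟩ : ∃ q, p = q + 2 := ⟨p - 2, by omega⟩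
  unfold jacobsonTerm
  apply K.smul_mem
  rw [← Submodule.Quotient.mk_eq_zero, ← Submodule.mkQ_apply, lid_rTensor_lTensor,
    show q + 2 - 1 = q + 1 by omega, pow_succ', Module.End.mul_apply, key]
  simp

theorem jacobsonTerm_eq_zero {p : ℕ} (hp : 2 ≤ p) (i : ℕ) {x y : L} (h : ⁅x, y⁆ = 0) :
    jacobsonTerm F p i x y = 0 := by
  obtain ⟨q, rfl⟩ : ∃ q, p = q + 2 := ⟨p - 2, by omega⟩
  have h' : ⁅y, x⁆ = 0 := by rw [← lie_skew, h, neg_zero]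
  unfold jacobsonTerm
  rw [show q + 2 - 1 = q + 1 by omega, pow_succ, Module.End.mul_apply, LieAlgebra.ad_apply]
  simp [LieAlgebra.ExtendScalars.bracket_tmul, h']

end Jacobson

section PMap

variable (p : ℕ) (F : Type u) [Field F] {L : Type v} [LieRing L] [LieAlgebra F L]
  [RestrictedLieAlgebra p F L]

theorem pMap_lie (x y : L) : ⁅pMap p F x, y⁆ = (LieAlgebra.ad F L x ^ p) y := by
  rw [← ad_pMap, LieAlgebra.ad_apply]

/-- If `ad x` maps a set `A` into an ideal `B`, then so does `ad x^[p]`. -/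
theorem pMap_lie_mem [hp : Fact p.Prime] {A : Set L} {B : LieIdeal F L} {x : L}
    (h : ∀ a ∈ A, ⁅x, a⁆ ∈ B) : ∀ a ∈ A, ⁅pMap p F x, a⁆ ∈ B := by
  intro a ha
  obtain ⟨q, hq⟩ : ∃ q, p = q + 1 := ⟨p - 1, by have := hp.out.two_le; omega⟩
  rw [pMap_lie, hq]
  clear hq
  induction q with
  | zero => simpa using h a ha
  | succ q ih =>
    rw [pow_succ', Module.End.mul_apply, LieAlgebra.ad_apply]
    exact lie_mem_right F L B _ _ ih

theorem pMap_zero [hp : Fact p.Prime] : pMap p F (0 : L) = 0 := by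
  have := pMap_smul (p := p) (0 : F) (0 : L)
  rwa [zero_pow hp.out.ne_zero, zero_smul, zero_smul] at this

theorem pMap_add_of_lie_eq_zero [hp : Fact p.Prime] {x y : L} (h : ⁅x, y⁆ = 0) :
    pMap p F (x + y) = pMap p F x + pMap p F y := by
  rw [pMap_add, Finset.sum_eq_zero fun i _ => jacobsonTerm_eq_zero hp.out.two_le i h, add_zero]

/-- Modulo a subspace that contains all brackets, the `p`-map is additive. -/
theorem pMap_add_sub_mem [hp : Fact p.Prime] {K : Submodule F L} (hK : ∀ a b : L, ⁅a, b⁆ ∈ K)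
    (x y : L) : pMap p F (x + y) - (pMap p F x + pMap p F y) ∈ K := by
  rw [pMap_add, add_sub_cancel_left]
  exact K.sum_mem fun i _ => jacobsonTerm_mem hp.out.two_le i x y K hK

theorem pMap_add_mem [hp : Fact p.Prime] {K : Submodule F L} (hK : ∀ a b : L, ⁅a, b⁆ ∈ K)
    {x y : L} (hx : pMap p F x ∈ K) (hy : pMap p F y ∈ K) : pMap p F (x + y) ∈ K := by
  have := K.add_mem (pMap_add_sub_mem p F hK x y) (K.add_mem hx hy)
  rwa [sub_add_cancel] at this

/-- A Lie subalgebra closed under the `p`-map is a restricted Lie algebra. -/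
@[reducible]
def ofLieSubalgebra (H : LieSubalgebra F L) (hH : ∀ x ∈ H, pMap p F x ∈ H) :
    RestrictedLieAlgebra p F H where
  pMap x := ⟨pMap p F (x : L), hH x x.2⟩
  ad_pMap x := by
    have key : ∀ (k : ℕ) (y : H),
        (((LieAlgebra.ad F H x ^ k) y : H) : L) = (LieAlgebra.ad F L (x : L) ^ k) (y : L) := by
      intro k y
      induction k with
      | zero => simp
      | succ k ih => simp [pow_succ', ih]
    ext y
    rw [key, ← pMap_lie]
    rfl
  pMap_smul a x := Subtype.ext (pMap_smul (p := p) a (x : L))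
  pMap_add x y := by
    apply Subtype.ext
    have h (i : ℕ) := map_jacobsonTerm H.incl p i x y
    simp only [LieSubalgebra.coe_incl] at h
    push_cast
    simp only [h]
    exact pMap_add (p := p) (F := F) (x : L) (y : L)

end PMap

end RestrictedLieAlgebra

/-! ### Eigenvectors of `p`-semilinear maps -/

section Semilinear

variable {p : ℕ} {F : Type u} [Field F] {V : Type v} [AddCommGroup V] [Module F V]

theorem iterate_smul_of_semilinear {φ : V → V} (hφ : ∀ (a : F) (x : V), φ (a • x) = a ^ p • φ x)
    (i : ℕ) (a : F) (x : V) : φ^[i] (a • x) = a ^ p ^ i • φ^[i] x := by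
  induction i with
  | zero => simp
  | succ i ih => rw [Function.iterate_succ_apply', Function.iterate_succ_apply', ih, hφ, ← pow_mul,
      pow_succ]

/-- A monic polynomial `τ ^ (n + 1) + ∑ i ≤ n, a i * τ ^ i` in the skew polynomial ring `F[τ]`,
`τ * c = c ^ p * τ`, over an algebraically closed field has a right factor `τ - c`: the quotient
is `∑ i ≤ n, q i * τ ^ i`. -/
theorem exists_skew_factor [IsAlgClosed F] [hp : Fact p.Prime] (n : ℕ) (a : ℕ → F) :
    ∃ (c : F) (q : ℕ → F), q n = 1 ∧
      (∀ i < n, a (i + 1) = q i - q (i + 1) * c ^ p ^ (i + 1)) ∧ a 0 = -(q 0 * c) := by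
  -- `R j` is the coefficient of `τ ^ (n - j)` in the quotient, as a polynomial in `c`;
  -- `R (n + 1)` is the remainder.
  let R : ℕ → Polynomial F := fun j => Nat.rec 1
    (fun j r => Polynomial.C (a (n - j)) + r * Polynomial.X ^ p ^ (n - j)) j
  have hR (j : ℕ) : R (j + 1) = Polynomial.C (a (n - j)) + R j * Polynomial.X ^ p ^ (n - j) := rfl
  have hdeg (r : Polynomial F) (hr : r.Monic) (k : ℕ) (b : F) :
      (Polynomial.C b + r * Polynomial.X ^ p ^ k).Monic ∧
        0 < (Polynomial.C b + r * Polynomial.X ^ p ^ k).degree := by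
    have hm : (r * Polynomial.X ^ p ^ k).Monic := hr.mul (Polynomial.monic_X_pow _)
    have hd : 0 < (r * Polynomial.X ^ p ^ k).degree := by
      rw [← Polynomial.natDegree_pos_iff_degree_pos,
        hr.natDegree_mul (Polynomial.monic_X_pow _), Polynomial.natDegree_X_pow]
      have := pow_pos hp.out.pos k
      omega
    have hlt : (Polynomial.C b).degree < (r * Polynomial.X ^ p ^ k).degree :=
      Polynomial.degree_C_le.trans_lt hd
    refine ⟨hm.add_of_right hlt, ?_⟩
    rwa [Polynomial.degree_add_eq_right_of_degree_lt hlt]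
  have hmonic (j : ℕ) : (R j).Monic := by
    induction j with
    | zero => exact Polynomial.monic_one
    | succ j ih => exact (hdeg _ ih _ _).1
  obtain ⟨c, hc⟩ := IsAlgClosed.exists_root (R (n + 1)) (hdeg _ (hmonic n) _ _).2.ne'
  refine ⟨c, fun i => (R (n - i)).eval c, ?_, fun i hi => ?_, ?_⟩
  · simp [R]
  · obtain ⟨j, rfl⟩ : ∃ j, n = i + 1 + j := ⟨n - (i + 1), by omega⟩
    have h1 : i + 1 + j - i = j + 1 := by omega
    have h2 : i + 1 + j - (i + 1) = j := by omega
    have h3 : i + 1 + j - j = i + 1 := by omega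
    simp only [h1, h2, hR, h3]
    simp
  · rw [Polynomial.IsRoot, hR] at hc
    simp only [Nat.sub_self, pow_zero, pow_one, Polynomial.eval_add, Polynomial.eval_C,
      Polynomial.eval_mul, Polynomial.eval_X] at hc
    simpa using eq_neg_of_add_eq_zero_left hc

/-- If a monic skew polynomial in `φ` kills `v ≠ 0`, split off a right factor `φ - c`: either
`φ v = c v`, or a skew polynomial of smaller degree kills `φ v - c v ≠ 0`. -/
theorem exists_eigenvector_of_relation [IsAlgClosed F] [Fact p.Prime] (φ : V →+ V)
    (hφ : ∀ (a : F) (x : V), φ (a • x) = a ^ p • φ x) (n : ℕ) (a : ℕ → F) (v : V) (hv : v ≠ 0)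
    (h : φ^[n] v + ∑ i ∈ Finset.range n, a i • φ^[i] v = 0) :
    ∃ (w : V) (c : F), w ≠ 0 ∧ φ w = c • w := by
  induction n generalizing a v with
  | zero => exact absurd (by simpa using h) hv
  | succ n ih =>
    obtain ⟨c, q, hqn, hq, hq0⟩ := exists_skew_factor (p := p) n a
    by_cases hw : φ v - c • v = 0
    · exact ⟨v, c, hv, sub_eq_zero.1 hw⟩
    refine ih q _ hw ?_
    have hit (i : ℕ) : φ^[i] (φ v - c • v) = φ^[i + 1] v - c ^ p ^ i • φ^[i] v := by
      rw [iterate_map_sub, iterate_smul_of_semilinear hφ, Function.iterate_succ_apply]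
    calc φ^[n] (φ v - c • v) + ∑ i ∈ Finset.range n, q i • φ^[i] (φ v - c • v)
        = ∑ i ∈ Finset.range (n + 1), q i • φ^[i] (φ v - c • v) := by
          rw [Finset.sum_range_succ, hqn, one_smul, add_comm]
      _ = ∑ i ∈ Finset.range (n + 1), q i • φ^[i + 1] v -
            ∑ i ∈ Finset.range (n + 1), (q i * c ^ p ^ i) • φ^[i] v := by
          rw [← Finset.sum_sub_distrib]
          exact Finset.sum_congr rfl fun i _ => by rw [hit, smul_sub, smul_smul]
      _ = φ^[n + 1] v + ∑ i ∈ Finset.range (n + 1), a i • φ^[i] v := by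
          rw [Finset.sum_range_succ, Finset.sum_range_succ' (fun i => (q i * c ^ p ^ i) • φ^[i] v),
            Finset.sum_range_succ' (fun i => a i • φ^[i] v), hqn, one_smul, hq0,
            Finset.sum_congr rfl fun i hi =>
              show a (i + 1) • φ^[i + 1] v = _ by rw [hq i (Finset.mem_range.1 hi), sub_smul],
            Finset.sum_sub_distrib, pow_zero, pow_one, neg_smul]
          abel
      _ = 0 := h

/-- The iterates of a self-map of a finite-dimensional space satisfy a monic relation. -/
theorem exists_iterate_mem_span [FiniteDimensional F V] (φ : V → V) (v : V) :
    ∃ n, φ^[n] v ∈ Submodule.span F ((fun i => φ^[i] v) '' Set.Iio n) := by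
  let U : ℕ →o Submodule F V := ⟨fun n => Submodule.span F ((fun i => φ^[i] v) '' Set.Iio n),
    fun m n h => Submodule.span_mono (Set.image_mono (Set.Iio_subset_Iio h))⟩
  obtain ⟨n, hn⟩ := monotone_stabilizes_iff_noetherian.2 (inferInstance : IsNoetherian F V) U
  refine ⟨n, ?_⟩
  change _ ∈ U n
  rw [hn (n + 1) n.le_succ]
  exact Submodule.subset_span ⟨n, Nat.lt_succ_self n, rfl⟩

/-- A `p`-semilinear map of a nonzero finite-dimensional vector space over an algebraically closed
field has an eigenvector. -/
theorem exists_eigenvector_of_semilinear [IsAlgClosed F] [Fact p.Prime] [FiniteDimensional F V]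
    [Nontrivial V] (φ : V →+ V) (hφ : ∀ (a : F) (x : V), φ (a • x) = a ^ p • φ x) :
    ∃ (w : V) (c : F), w ≠ 0 ∧ φ w = c • w := by
  obtain ⟨v, hv⟩ := exists_ne (0 : V)
  obtain ⟨n, hn⟩ := exists_iterate_mem_span (F := F) φ v
  obtain ⟨a, has, ha⟩ := (Finsupp.mem_span_image_iff_linearCombination F).1 hn
  have hsub : a.support ⊆ Finset.range n := fun i hi => Finset.mem_range.2 (has hi)
  refine exists_eigenvector_of_relation φ hφ n (fun i => -a i) v hv ?_
  rw [← ha, Finsupp.linearCombination_apply, Finsupp.sum_of_support_subset _ hsub _ (by simp)]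
  simp

end Semilinear

/-! ### A restricted subalgebra of codimension one -/

namespace RestrictedLieAlgebra

variable (p : ℕ) (F : Type u) [Field F] (L : Type v) [LieRing L] [LieAlgebra F L]
  [RestrictedLieAlgebra p F L]

/-- A nonzero solvable restricted Lie algebra `L` has a proper ideal that contains `[L, L]` and is
closed under the `p`-map. With `L' = [L, L]` and `L'' = [L', L']`, one of the following works:
`{z | [z, L'] ⊆ L''}`, or `{z | [z, L] ⊆ L''}`, or `0`. -/
theorem exists_proper_pMap_closed [Fact p.Prime] [LieAlgebra.IsSolvable L] [Nontrivial L] :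
    ∃ K : Submodule F L, K ≠ ⊤ ∧ (∀ x y : L, ⁅x, y⁆ ∈ K) ∧ ∀ x ∈ K, pMap p F x ∈ K := by
  set D1 : LieIdeal F L := LieAlgebra.derivedSeries F L 1 with hD1
  set D2 : LieIdeal F L := LieAlgebra.derivedSeries F L 2 with hD2
  have h1 : D1 = ⁅(⊤ : LieIdeal F L), (⊤ : LieIdeal F L)⁆ := by
    rw [hD1, LieAlgebra.derivedSeries_def, LieAlgebra.derivedSeriesOfIdeal_succ,
      LieAlgebra.derivedSeriesOfIdeal_zero]
  have h2 : D2 = ⁅D1, D1⁆ := by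
    rw [hD1, hD2, LieAlgebra.derivedSeries_def, LieAlgebra.derivedSeriesOfIdeal_succ]
  have hmem (x y : L) : ⁅x, y⁆ ∈ D1 := by
    rw [h1]; exact LieSubmodule.lie_mem_lie (LieSubmodule.mem_top _) (LieSubmodule.mem_top _)
  let C (A : Set L) : Submodule F L :=
    { carrier := {z | ∀ a ∈ A, ⁅z, a⁆ ∈ D2}
      zero_mem' := fun a _ => by rw [zero_lie]; exact D2.zero_mem
      add_mem' := fun hx hy a ha => by rw [add_lie]; exact D2.add_mem (hx a ha) (hy a ha)
      smul_mem' := fun c x hx a ha => by rw [smul_lie]; exact D2.smul_mem c (hx a ha) }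
  have hC (A : Set L) : ∀ x ∈ C A, pMap p F x ∈ C A := fun x hx => pMap_lie_mem p F hx
  by_cases c1 : C D1 = ⊤
  swap
  · refine ⟨C D1, c1, fun x y a ha => ?_, hC _⟩
    rw [h2]; exact LieSubmodule.lie_mem_lie (hmem x y) ha
  have c1' (x a : L) (ha : a ∈ D1) : ⁅x, a⁆ ∈ D2 := by
    have : x ∈ C D1 := by rw [c1]; exact Submodule.mem_top
    exact this a ha
  by_cases c2 : C Set.univ = ⊤
  swap
  · refine ⟨C Set.univ, c2, fun x y a _ => ?_, hC _⟩
    rw [← lie_skew]; exact D2.neg_mem (c1' _ _ (hmem x y))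
  have c2' : D1 ≤ D2 := by
    rw [h1]
    refine (LieSubmodule.lie_le_iff _ _ _).2 fun x _ m _ => ?_
    have : x ∈ C Set.univ := by rw [c2]; exact Submodule.mem_top
    exact this m trivial
  have hle (k : ℕ) : D1 ≤ LieAlgebra.derivedSeries F L (k + 1) := by
    induction k with
    | zero => exact le_rfl
    | succ k ih =>
      refine c2'.trans ?_
      rw [h2, LieAlgebra.derivedSeries_def, LieAlgebra.derivedSeriesOfIdeal_succ]
      exact LieSubmodule.mono_lie ih ih
  obtain ⟨k, hk⟩ := LieAlgebra.IsSolvable.solvable F L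
  have hbot : D1 = ⊥ := by
    rw [eq_bot_iff, ← hk]
    exact (hle k).trans (LieAlgebra.derivedSeriesOfIdeal_succ_le ⊤ k)
  refine ⟨⊥, bot_ne_top, fun x y => ?_, fun x hx => ?_⟩
  · have := hmem x y
    rwa [hbot] at this
  · rw [Submodule.mem_bot] at hx ⊢
    rw [hx, pMap_zero]

/-- A nonzero solvable restricted Lie algebra is `H + F x` for a restricted subalgebra `H`
containing `[L, L]` and some `x` that is an eigenvector of the `p`-map modulo `H`. -/
theorem exists_codim_one [Fact p.Prime] [CharP F p] [IsAlgClosed F] [FiniteDimensional F L]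
    [LieAlgebra.IsSolvable L] [Nontrivial L] :
    ∃ (H : LieSubalgebra F L) (x : L) (c : F), (∀ y z : L, ⁅y, z⁆ ∈ H) ∧
      (∀ y ∈ H, pMap p F y ∈ H) ∧ x ∉ H ∧ pMap p F x - c • x ∈ H ∧
      ∀ y : L, ∃ h ∈ H, ∃ a : F, y = h + a • x := by
  obtain ⟨H, ⟨hne, hlie, hp⟩, hmax⟩ := exists_maximal_of_wellFoundedGT
    (fun K : Submodule F L => K ≠ ⊤ ∧ (∀ x y : L, ⁅x, y⁆ ∈ K) ∧ ∀ x ∈ K, pMap p F x ∈ K)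
    (exists_proper_pMap_closed p F L)
  have : Nontrivial (L ⧸ H) := Submodule.Quotient.nontrivial_iff.2 hne
  have : ExpChar F p := ExpChar.prime Fact.out
  let ψ : L →ₛₗ[frobenius F p] L ⧸ H :=
    { toFun := fun x => H.mkQ (pMap p F x)
      map_add' := fun x y => by
        rw [← map_add]
        exact (Submodule.Quotient.eq H).2 (pMap_add_sub_mem p F hlie x y)
      map_smul' := fun a x => by rw [pMap_smul, map_smul, frobenius_def] }
  let φ := H.liftQ ψ fun x hx => (Submodule.Quotient.mk_eq_zero H).2 (hp x hx)
  obtain ⟨w, c, hw, hwc⟩ := exists_eigenvector_of_semilinear (p := p) (F := F) φ.toAddMonoidHom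
    fun a x => by simp [frobenius_def]
  obtain ⟨x, rfl⟩ := Submodule.mkQ_surjective H w
  have hx : x ∉ H := fun h => hw ((Submodule.Quotient.mk_eq_zero H).2 h)
  have hxc : pMap p F x - c • x ∈ H := (Submodule.Quotient.eq H).1 hwc
  have htop : H ⊔ F ∙ x = ⊤ := by
    by_contra hcon
    refine hx (hmax ⟨hcon, fun y z => Submodule.mem_sup_left (hlie y z), ?_⟩ le_sup_left
      (Submodule.mem_sup_right (Submodule.mem_span_singleton_self x)))
    intro y hy
    obtain ⟨h, hh, z, hz, rfl⟩ := Submodule.mem_sup.1 hy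
    obtain ⟨a, rfl⟩ := Submodule.mem_span_singleton.1 hz
    refine pMap_add_mem p F (fun y z => Submodule.mem_sup_left (hlie y z))
      (Submodule.mem_sup_left (hp h hh)) ?_
    rw [pMap_smul, ← sub_add_cancel (pMap p F x) (c • x)]
    exact Submodule.smul_mem _ _ (add_mem (Submodule.mem_sup_left hxc)
      (Submodule.mem_sup_right (Submodule.mem_span_singleton.2 ⟨c, rfl⟩)))
  refine ⟨{ H with lie_mem' := fun _ _ => hlie _ _ }, x, c, hlie, hp, hx, hxc, fun y => ?_⟩
  obtain ⟨h, hh, z, hz, hy⟩ := Submodule.mem_sup.1 (show y ∈ H ⊔ F ∙ x by rw [htop]; trivial)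
  obtain ⟨a, rfl⟩ := Submodule.mem_span_singleton.1 hz
  exact ⟨h, hh, a, hy.symm⟩

end RestrictedLieAlgebra

/-! ### Tori -/

namespace RestrictedLieAlgebra

section Torus

variable (p : ℕ) (F : Type u) [Field F] {L : Type v} [LieRing L] [LieAlgebra F L]
  [RestrictedLieAlgebra p F L]

theorem lie_pMap_eq_zero [hp : Fact p.Prime] {x y : L} (h : ⁅x, y⁆ = 0) :
    ⁅x, pMap p F y⁆ = 0 := by
  obtain ⟨q, hq⟩ : ∃ q, p = q + 1 := ⟨p - 1, by have := hp.out.two_le; omega⟩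
  have h' : ⁅y, x⁆ = 0 := by rw [← lie_skew, h, neg_zero]
  rw [← lie_skew, pMap_lie, neg_eq_zero, hq, pow_succ, Module.End.mul_apply, LieAlgebra.ad_apply,
    h', map_zero]

theorem lie_iterate_pMap_eq_zero [Fact p.Prime] {x y : L} (h : ⁅x, y⁆ = 0) (n : ℕ) :
    ⁅x, (pMap p F)^[n] y⁆ = 0 := by
  induction n with
  | zero => exact h
  | succ n ih =>
    rw [Function.iterate_succ_apply']
    exact lie_pMap_eq_zero p F ih

theorem iterate_pMap_lie_iterate_pMap [Fact p.Prime] {x y : L} (h : ⁅x, y⁆ = 0) (m n : ℕ) :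
    ⁅(pMap p F)^[m] x, (pMap p F)^[n] y⁆ = 0 := by
  refine lie_iterate_pMap_eq_zero p F ?_ n
  rw [← lie_skew, lie_iterate_pMap_eq_zero p F (by rw [← lie_skew, h, neg_zero]), neg_zero]

theorem iterate_pMap_add_of_lie_eq_zero [Fact p.Prime] {x y : L} (h : ⁅x, y⁆ = 0) (n : ℕ) :
    (pMap p F)^[n] (x + y) = (pMap p F)^[n] x + (pMap p F)^[n] y := by
  induction n with
  | zero => rfl
  | succ n ih =>
    simp only [Function.iterate_succ_apply', ih]
    exact pMap_add_of_lie_eq_zero p F (iterate_pMap_lie_iterate_pMap p F h n n)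

theorem iterate_pMap_zero [Fact p.Prime] (n : ℕ) : (pMap p F)^[n] (0 : L) = 0 :=
  Function.iterate_fixed (pMap_zero p F) n

theorem iterate_pMap_smul (n : ℕ) (a : F) (x : L) :
    (pMap p F)^[n] (a • x) = a ^ p ^ n • (pMap p F)^[n] x :=
  iterate_smul_of_semilinear pMap_smul n a x

theorem iterate_pMap_lie (n : ℕ) (x y : L) :
    ⁅(pMap p F)^[n] x, y⁆ = (LieAlgebra.ad F L x ^ p ^ n) y := by
  induction n generalizing y with
  | zero => simp
  | succ n ih =>
    have : LieAlgebra.ad F L ((pMap p F)^[n] x) = LieAlgebra.ad F L x ^ p ^ n :=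
      LinearMap.ext fun z => ih z
    rw [Function.iterate_succ_apply', pMap_lie, this, ← pow_mul, pow_succ]

/-- The spans of the tails of the sequence of iterates of `x` stabilize. -/
theorem exists_iterate_pMap_mem_span [FiniteDimensional F L] (x : L) :
    ∃ n, (pMap p F)^[n] x ∈
      Submodule.span F (Set.range fun i : ℕ => (pMap p F)^[n + (i + 1)] x) := by
  let U : ℕ →o (Submodule F L)ᵒᵈ :=
    ⟨fun n => OrderDual.toDual (Submodule.span F ((fun i => (pMap p F)^[i] x) '' Set.Ici n)),
      fun m n h => Submodule.span_mono (Set.image_mono (Set.Ici_subset_Ici.2 h))⟩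
  obtain ⟨n, hn⟩ := IsArtinian.monotone_stabilizes U
  refine ⟨n, ?_⟩
  have h : (pMap p F)^[n] x ∈ OrderDual.ofDual (U n) :=
    Submodule.subset_span ⟨n, Set.self_mem_Ici, rfl⟩
  rw [hn (n + 1) n.le_succ] at h
  refine Submodule.span_mono ?_ h
  rintro _ ⟨i, hi, rfl⟩
  have hi' : n + 1 ≤ i := hi
  exact ⟨i - (n + 1), by dsimp only; congr 1; omega⟩

theorem exists_isSemisimpleElement_iterate [FiniteDimensional F L] (x : L) :
    ∃ n, IsSemisimpleElement p F ((pMap p F)^[n] x) := by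
  obtain ⟨n, hn⟩ := exists_iterate_pMap_mem_span p F x
  refine ⟨n, ?_⟩
  unfold IsSemisimpleElement
  simp only [← Function.iterate_add_apply]
  simpa only [add_comm n] using hn

/-- An abelian subspace on which the `p`-map restricts to a surjection is toral: the
`p`-map is then injective on it, as the kernels of its iterates stabilize, so a relation
between iterates of `z` can be divided by the `p`-map until it expresses `z` itself. -/
theorem isSemisimpleElement_of_surjOn [hp : Fact p.Prime] [IsAlgClosed F] [FiniteDimensional F L]
    (S : Submodule F L) (hcomm : ∀ a ∈ S, ∀ b ∈ S, ⁅a, b⁆ = 0) (hmem : ∀ a ∈ S, pMap p F a ∈ S)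
    (hsurj : ∀ a ∈ S, ∃ b ∈ S, pMap p F b = a) :
    ∀ z ∈ S, IsSemisimpleElement p F z := by
  have hmem' (n : ℕ) : ∀ a ∈ S, (pMap p F)^[n] a ∈ S := by
    induction n with
    | zero => exact fun a ha => ha
    | succ n ih => exact fun a ha => ih _ (hmem a ha)
  have hsurj' (n : ℕ) : ∀ a ∈ S, ∃ b ∈ S, (pMap p F)^[n] b = a := by
    induction n with
    | zero => exact fun a ha => ⟨a, ha, rfl⟩
    | succ n ih =>
      intro a ha
      obtain ⟨b, hb, rfl⟩ := ih a ha
      obtain ⟨d, hd, rfl⟩ := hsurj b hb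
      exact ⟨d, hd, rfl⟩
  let K : ℕ →o Submodule F L :=
    ⟨fun n =>
      { carrier := {a | a ∈ S ∧ (pMap p F)^[n] a = 0}
        zero_mem' := ⟨S.zero_mem, iterate_pMap_zero p F n⟩
        add_mem' := fun ha hb => ⟨S.add_mem ha.1 hb.1, by
          rw [iterate_pMap_add_of_lie_eq_zero p F (hcomm _ ha.1 _ hb.1), ha.2, hb.2, add_zero]⟩
        smul_mem' := fun c a ha => ⟨S.smul_mem c ha.1, by
          rw [iterate_pMap_smul, ha.2, smul_zero]⟩ },
      monotone_nat_of_le_succ fun n a ha => ⟨ha.1, by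
        rw [Function.iterate_succ_apply', ha.2, pMap_zero]⟩⟩
  obtain ⟨m, hm⟩ := monotone_stabilizes_iff_noetherian.2 (inferInstance : IsNoetherian F L) K
  have hinj : ∀ a ∈ S, pMap p F a = 0 → a = 0 := by
    intro a ha h0
    obtain ⟨b, hb, rfl⟩ := hsurj' m a ha
    have hb' : b ∈ K (m + 1) := ⟨hb, by rw [Function.iterate_succ_apply', h0]⟩
    rw [← hm (m + 1) m.le_succ] at hb'
    exact hb'.2
  have hinj' (n : ℕ) : ∀ a ∈ S, (pMap p F)^[n] a = 0 → a = 0 := by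
    induction n with
    | zero => exact fun a _ h => h
    | succ n ih => exact fun a ha h => hinj a ha (ih _ (hmem a ha) h)
  intro z hz
  obtain ⟨n, hn⟩ := exists_iterate_pMap_mem_span p F z
  have hle : Submodule.span F (Set.range fun i : ℕ => (pMap p F)^[i + 1] z) ≤ S :=
    Submodule.span_le.2 (by rintro _ ⟨i, rfl⟩; exact hmem' _ z hz)
  have hdiv : ∀ u ∈ Submodule.span F (Set.range fun i : ℕ => (pMap p F)^[n + (i + 1)] z),
      ∃ t ∈ Submodule.span F (Set.range fun i : ℕ => (pMap p F)^[i + 1] z),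
        (pMap p F)^[n] t = u := by
    intro u hu
    induction hu using Submodule.span_induction with
    | mem u hu =>
      obtain ⟨i, rfl⟩ := hu
      exact ⟨_, Submodule.subset_span ⟨i, rfl⟩, by rw [← Function.iterate_add_apply]⟩
    | zero => exact ⟨0, Submodule.zero_mem _, iterate_pMap_zero p F n⟩
    | add u₁ u₂ _ _ h₁ h₂ =>
      obtain ⟨t₁, ht₁, rfl⟩ := h₁
      obtain ⟨t₂, ht₂, rfl⟩ := h₂
      exact ⟨t₁ + t₂, add_mem ht₁ ht₂,
        iterate_pMap_add_of_lie_eq_zero p F (hcomm _ (hle ht₁) _ (hle ht₂)) n⟩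
    | smul a u _ h =>
      obtain ⟨t, ht, rfl⟩ := h
      obtain ⟨b, rfl⟩ := IsAlgClosed.exists_pow_nat_eq a (pow_pos hp.out.pos n)
      exact ⟨b • t, Submodule.smul_mem _ b ht, iterate_pMap_smul p F n b t⟩
  obtain ⟨t, ht, htn⟩ := hdiv _ hn
  have hzt : z = t := by
    refine sub_eq_zero.1 (hinj' n _ (S.sub_mem hz (hle ht)) ?_)
    have h := iterate_pMap_add_of_lie_eq_zero p F
      (hcomm _ (S.sub_mem hz (hle ht)) _ (hle ht)) n
    rwa [sub_add_cancel, htn, right_eq_add] at h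
  unfold IsSemisimpleElement
  rwa [← hzt] at ht

/-- A set `G` of pairwise commuting elements that is closed under the `p`-map and lies in the span
of its image under the `p`-map spans a torus. -/
theorem exists_isTorus_span [hp : Fact p.Prime] [IsAlgClosed F] [FiniteDimensional F L]
    (G : Set L) (hcomm : ∀ a ∈ G, ∀ b ∈ G, ⁅a, b⁆ = 0) (hmem : ∀ a ∈ G, pMap p F a ∈ G)
    (hspan : ∀ a ∈ G, a ∈ Submodule.span F (pMap p F '' G)) :
    ∃ T : LieSubalgebra F L, IsTorus p F T ∧ T.toSubmodule = Submodule.span F G := by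
  have hcomm' : ∀ a ∈ Submodule.span F G, ∀ b ∈ Submodule.span F G, ⁅a, b⁆ = 0 := by
    intro a ha b hb
    induction ha, hb using Submodule.span_induction₂ with
    | mem_mem x y hx hy => exact hcomm x hx y hy
    | zero_left y hy => exact zero_lie y
    | zero_right x hx => exact lie_zero x
    | add_left x y z hx hy hz h₁ h₂ => rw [add_lie, h₁, h₂, add_zero]
    | add_right x y z hx hy hz h₁ h₂ => rw [lie_add, h₁, h₂, add_zero]
    | smul_left r x y hx hy h => rw [smul_lie, h, smul_zero]
    | smul_right r x y hx hy h => rw [lie_smul, h, smul_zero]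
  have hmem' : ∀ a ∈ Submodule.span F G, pMap p F a ∈ Submodule.span F G := by
    intro a ha
    induction ha using Submodule.span_induction with
    | mem x hx => exact Submodule.subset_span (hmem x hx)
    | zero => rw [pMap_zero]; exact Submodule.zero_mem _
    | add x y hx hy h₁ h₂ =>
      rw [pMap_add_of_lie_eq_zero p F (hcomm' x hx y hy)]; exact add_mem h₁ h₂
    | smul r x _ h => rw [pMap_smul]; exact Submodule.smul_mem _ _ h
  have hsurj : ∀ a ∈ Submodule.span F G, ∃ b ∈ Submodule.span F G, pMap p F b = a := by
    intro a ha
    have ha' : a ∈ Submodule.span F (pMap p F '' G) := Submodule.span_le.2 hspan ha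
    clear ha
    induction ha' using Submodule.span_induction with
    | mem x hx =>
      obtain ⟨g, hg, rfl⟩ := hx
      exact ⟨g, Submodule.subset_span hg, rfl⟩
    | zero => exact ⟨0, Submodule.zero_mem _, pMap_zero p F⟩
    | add x y _ _ h₁ h₂ =>
      obtain ⟨s, hs, rfl⟩ := h₁
      obtain ⟨t, ht, rfl⟩ := h₂
      exact ⟨s + t, add_mem hs ht, pMap_add_of_lie_eq_zero p F (hcomm' s hs t ht)⟩
    | smul r x _ h =>
      obtain ⟨s, hs, rfl⟩ := h
      obtain ⟨b, rfl⟩ := IsAlgClosed.exists_pow_nat_eq r hp.out.pos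
      exact ⟨b • s, Submodule.smul_mem _ b hs, pMap_smul b s⟩
  refine ⟨{ Submodule.span F G with
    lie_mem' := fun {a b} ha hb => by
      change ⁅a, b⁆ ∈ Submodule.span F G
      rw [hcomm' a ha b hb]; exact Submodule.zero_mem _ }, ⟨hmem', hcomm', ?_⟩, rfl⟩
  exact isSemisimpleElement_of_surjOn p F _ hcomm' hmem' hsurj

/-- If `t` is semisimple, then `ad t` vanishes on a vector of every coset of a subspace that
contains all brackets. The correction is by a polynomial without constant term in `ad t`, so it
preserves commutation with anything that commutes with `t`. -/
theorem IsSemisimpleElement.exists_lie_eq_zero [hp : Fact p.Prime] {t : L}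
    (ht : IsSemisimpleElement p F t) {K : Submodule F L} (hK : ∀ a b : L, ⁅a, b⁆ ∈ K) (x : L) :
    ∃ y, y - x ∈ K ∧ ⁅t, y⁆ = 0 ∧ ∀ s : L, ⁅s, t⁆ = 0 → ⁅s, x⁆ = 0 → ⁅s, y⁆ = 0 := by
  have key : ∀ u ∈ Submodule.span F (Set.range fun i : ℕ => (pMap p F : L → L)^[i + 1] t),
      ∃ z ∈ K, ⁅u, x⁆ = ⁅t, z⁆ ∧ ∀ s : L, ⁅s, t⁆ = 0 → ⁅s, x⁆ = 0 → ⁅s, z⁆ = 0 := by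
    intro u hu
    induction hu using Submodule.span_induction with
    | mem u hu =>
      obtain ⟨i, rfl⟩ := hu
      obtain ⟨k, hk⟩ : ∃ k, p ^ (i + 1) = k + 2 := by
        refine ⟨p ^ (i + 1) - 2, ?_⟩
        have h1 := hp.out.two_le
        have h2 : p ≤ p ^ (i + 1) := Nat.le_self_pow (by omega) p
        omega
      refine ⟨(LieAlgebra.ad F L t ^ (k + 1)) x, ?_, ?_, fun s hst hsx => ?_⟩
      · rw [pow_succ', Module.End.mul_apply]; exact hK _ _
      · rw [iterate_pMap_lie, hk, pow_succ', Module.End.mul_apply, LieAlgebra.ad_apply]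
      · generalize k + 1 = m
        induction m with
        | zero => simpa using hsx
        | succ m ih =>
          rw [pow_succ', Module.End.mul_apply, LieAlgebra.ad_apply, leibniz_lie, hst, ih,
            zero_lie, lie_zero, add_zero]
    | zero => exact ⟨0, K.zero_mem, by simp, fun s _ _ => lie_zero s⟩
    | add u₁ u₂ _ _ h₁ h₂ =>
      obtain ⟨z₁, hz₁, e₁, c₁⟩ := h₁
      obtain ⟨z₂, hz₂, e₂, c₂⟩ := h₂
      exact ⟨z₁ + z₂, K.add_mem hz₁ hz₂, by rw [add_lie, lie_add, e₁, e₂],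
        fun s h h' => by rw [lie_add, c₁ s h h', c₂ s h h', add_zero]⟩
    | smul a u _ h =>
      obtain ⟨z, hz, e, c⟩ := h
      exact ⟨a • z, K.smul_mem a hz, by rw [smul_lie, lie_smul, e],
        fun s h h' => by rw [lie_smul, c s h h', smul_zero]⟩
  obtain ⟨z, hz, e, c⟩ := key t ht
  exact ⟨x - z, by simpa using K.neg_mem hz, by rw [lie_sub, e, sub_self],
    fun s h h' => by rw [lie_sub, h', c s h h', sub_zero]⟩

/-- A torus centralizes a vector of every coset of a subspace that contains all brackets. -/
theorem IsTorus.exists_lie_eq_zero [hp : Fact p.Prime] [FiniteDimensional F L]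
    {T : LieSubalgebra F L} (hT : IsTorus p F T) {K : Submodule F L}
    (hK : ∀ a b : L, ⁅a, b⁆ ∈ K) (x : L) : ∃ y, y - x ∈ K ∧ ∀ t ∈ T, ⁅t, y⁆ = 0 := by
  classical
  obtain ⟨s, hs⟩ := IsNoetherian.noetherian T.toSubmodule
  have key : ∀ r : Finset L, (∀ t ∈ r, t ∈ T) → ∃ y, y - x ∈ K ∧ ∀ t ∈ r, ⁅t, y⁆ = 0 := by
    intro r
    induction r using Finset.induction_on with
    | empty => exact fun _ => ⟨x, by simp, by simp⟩
    | insert t r _ ih =>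
      intro h
      obtain ⟨y, hy, hyr⟩ := ih fun t' ht' => h t' (Finset.mem_insert_of_mem ht')
      have ht := h t (Finset.mem_insert_self t r)
      obtain ⟨z, hz, htz, hcz⟩ := (hT.semisimple t ht).exists_lie_eq_zero p F hK y
      refine ⟨z, by simpa using K.add_mem hz hy, fun t' ht' => ?_⟩
      rcases Finset.mem_insert.1 ht' with rfl | ht''
      · exact htz
      · exact hcz t' (hT.abelian _ (h t' ht') _ ht) (hyr t' ht'')
  obtain ⟨y, hy, hys⟩ := key s fun t ht => by
    rw [← LieSubalgebra.mem_toSubmodule, ← hs]; exact Submodule.subset_span ht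
  refine ⟨y, hy, fun t ht => ?_⟩
  rw [← LieSubalgebra.mem_toSubmodule, ← hs] at ht
  induction ht using Submodule.span_induction with
  | mem t ht => exact hys t ht
  | zero => exact zero_lie y
  | add a b _ _ ha hb => rw [add_lie, ha, hb, add_zero]
  | smul c a _ ha => rw [smul_lie, ha, smul_zero]

/-- A torus inside a restricted subalgebra `H ⊇ [L, L]` can be enlarged by one dimension, if the
`p`-map has an eigenvector modulo `H` with nonzero eigenvalue. -/
theorem IsTorus.exists_finrank_lt [hp : Fact p.Prime] [IsAlgClosed F] [FiniteDimensional F L]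
    {T : LieSubalgebra F L} (hT : IsTorus p F T) {H : LieSubalgebra F L} (hTH : T ≤ H)
    (hlie : ∀ a b : L, ⁅a, b⁆ ∈ H) (hpH : ∀ a ∈ H, pMap p F a ∈ H) {x : L} {c : F} (hx : x ∉ H)
    (hc : c ≠ 0) (hxc : pMap p F x - c • x ∈ H) :
    ∃ T' : LieSubalgebra F L, IsTorus p F T' ∧ Module.finrank F T < Module.finrank F T' := by
  have hlie' : ∀ a b : L, ⁅a, b⁆ ∈ H.toSubmodule := hlie
  -- eigenvectors modulo `H` are stable under translation by `H` and under the `p`-map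
  have htrans : ∀ (a h : L) (d : F), h ∈ H → pMap p F a - d • a ∈ H →
      pMap p F (a + h) - d • (a + h) ∈ H := by
    intro a h d hh ha
    have h1 : pMap p F (a + h) - (pMap p F a + pMap p F h) ∈ H := pMap_add_sub_mem p F hlie' a h
    have h2 := add_mem (add_mem h1 ha) (sub_mem (hpH h hh) (H.smul_mem d hh))
    convert h2 using 1
    rw [smul_add]; abel
  obtain ⟨y, hyx, hyT⟩ := hT.exists_lie_eq_zero p F hlie' x
  have hiter (n : ℕ) : (pMap p F)^[n] y ∉ H ∧
      ∃ d : F, d ≠ 0 ∧ pMap p F ((pMap p F)^[n] y) - d • (pMap p F)^[n] y ∈ H := by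
    induction n with
    | zero =>
      refine ⟨fun h => hx ?_, c, hc, ?_⟩
      · simpa using sub_mem (show y ∈ H from h) hyx
      · simpa using htrans x (y - x) c hyx hxc
    | succ n ih =>
      obtain ⟨hn, d, hd, hdn⟩ := ih
      rw [Function.iterate_succ_apply']
      set a := (pMap p F)^[n] y
      refine ⟨fun h => hn ?_, d ^ p, pow_ne_zero p hd, ?_⟩
      · have := H.smul_mem d⁻¹ (sub_mem h hdn)
        rwa [sub_sub_cancel, inv_smul_smul₀ hd] at this
      · have h1 : pMap p F (d • a) - d ^ p • pMap p F a ∈ H := by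
          rw [pMap_smul, sub_self]; exact H.zero_mem
        have h2 : pMap p F (d • a + (pMap p F a - d • a)) -
            (pMap p F (d • a) + pMap p F (pMap p F a - d • a)) ∈ H :=
          pMap_add_sub_mem p F hlie' _ _
        have h3 := add_mem (add_mem h2 (hpH _ hdn)) h1
        rw [add_sub_cancel] at h3
        convert h3 using 1
        abel
  obtain ⟨n, hn⟩ := exists_isSemisimpleElement_iterate p F y
  have hzH := (hiter n).1
  have hzT (t : L) (ht : t ∈ T) : ⁅t, (pMap p F)^[n] y⁆ = 0 :=
    lie_iterate_pMap_eq_zero p F (hyT t ht) n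
  set z := (pMap p F)^[n] y
  obtain ⟨T', hT', hspan⟩ := exists_isTorus_span p F
    ((T : Set L) ∪ Set.range fun i : ℕ => (pMap p F)^[i] z) (by
      rintro a (ha | ⟨i, rfl⟩) b (hb | ⟨j, rfl⟩)
      · exact hT.abelian a ha b hb
      · exact lie_iterate_pMap_eq_zero p F (hzT a ha) j
      · rw [← lie_skew, lie_iterate_pMap_eq_zero p F (hzT b hb) i, neg_zero]
      · exact iterate_pMap_lie_iterate_pMap p F (lie_self z) i j) (by
      rintro a (ha | ⟨i, rfl⟩)
      · exact Or.inl (hT.pMap_mem a ha)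
      · exact Or.inr ⟨i + 1, Function.iterate_succ_apply' _ _ _⟩) (by
      rintro a (ha | ⟨i, rfl⟩)
      · refine Submodule.span_mono ?_ (hT.semisimple a ha)
        rintro _ ⟨i, rfl⟩
        refine ⟨(pMap p F)^[i] a, Or.inl ?_, (Function.iterate_succ_apply' _ _ _).symm⟩
        induction i with
        | zero => exact ha
        | succ i ih => rw [Function.iterate_succ_apply']; exact hT.pMap_mem _ ih
      · rcases i with _ | i
        · refine Submodule.span_mono ?_ hn
          rintro _ ⟨i, rfl⟩
          exact ⟨(pMap p F)^[i] z, Or.inr ⟨i, rfl⟩, (Function.iterate_succ_apply' _ _ _).symm⟩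
        · exact Submodule.subset_span
            ⟨(pMap p F)^[i] z, Or.inr ⟨i, rfl⟩, (Function.iterate_succ_apply' _ _ _).symm⟩)
  refine ⟨T', hT', Submodule.finrank_lt_finrank_of_lt (lt_of_le_of_ne ?_ ?_ :
    T.toSubmodule < T'.toSubmodule)⟩
  · rw [hspan]
    exact fun t ht => Submodule.subset_span (Or.inl ht)
  · intro h
    refine hzH (hTH ?_)
    rw [← LieSubalgebra.mem_toSubmodule, h, hspan]
    exact Submodule.subset_span (Or.inr ⟨0, rfl⟩)

/-- The image in `L` of a torus of a restricted subalgebra `H`. -/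
theorem IsTorus.map_incl {H : LieSubalgebra F L} [RestrictedLieAlgebra p F H]
    (hH : ∀ x : H, ((pMap p F x : H) : L) = pMap p F (x : L)) {T : LieSubalgebra F H}
    (hT : IsTorus p F T) : IsTorus p F (T.map H.incl) := by
  have hcoe (i : ℕ) (x : H) : (((pMap p F)^[i] x : H) : L) = (pMap p F)^[i] (x : L) := by
    induction i with
    | zero => rfl
    | succ i ih => rw [Function.iterate_succ_apply', Function.iterate_succ_apply', ← ih, hH]
  refine ⟨?_, ?_, ?_⟩
  · rintro _ ⟨x, hx, rfl⟩
    exact ⟨pMap p F x, hT.pMap_mem x hx, hH x⟩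
  · rintro _ ⟨x, hx, rfl⟩ _ ⟨y, hy, rfl⟩
    exact congrArg Subtype.val (hT.abelian x hx y hy)
  · rintro _ ⟨x, hx, rfl⟩
    have h := Submodule.mem_map_of_mem (f := H.toSubmodule.subtype) (hT.semisimple x hx)
    rw [Submodule.map_span, ← Set.range_comp] at h
    unfold IsSemisimpleElement
    have he : (fun i : ℕ => (pMap p F : L → L)^[i + 1] (H.incl x)) =
        H.toSubmodule.subtype ∘ fun i : ℕ => (pMap p F : H → H)^[i + 1] x :=
      funext fun i => (hcoe (i + 1) x).symm
    rw [← he] at h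
    exact h

theorem IsTorus.finrank_le_maxTorusDim [FiniteDimensional F L] {T : LieSubalgebra F L}
    (hT : IsTorus p F T) : Module.finrank F T ≤ maxTorusDim p F L :=
  le_csSup ⟨Module.finrank F L, by rintro _ ⟨T', _, rfl⟩; exact T'.toSubmodule.finrank_le⟩
    ⟨T, hT, rfl⟩

end Torus

end RestrictedLieAlgebra

/-! ### Modules over a subalgebra of codimension one -/

namespace RestrictedLieAlgebra

section PowerSum

variable {F : Type u} [Field F] {L : Type v} [LieRing L] [LieAlgebra F L]
  {M : Type w} [AddCommGroup M] [Module F M] [LieRingModule L M] [LieModule F L M]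

/-- The subspace `N + x N + ⋯ + x ^ (k - 1) N` of an `L`-module. -/
def powerSum (x : L) (N : Submodule F M) (k : ℕ) : Submodule F M :=
  ⨆ j : Fin k, N.map (LieModule.toEnd F L M x ^ (j : ℕ))

variable {x : L} {N : Submodule F M}

theorem pow_apply_mem_powerSum {j k : ℕ} (hj : j < k) {m : M} (hm : m ∈ N) :
    (LieModule.toEnd F L M x ^ j) m ∈ powerSum x N k :=
  Submodule.mem_iSup_of_mem (⟨j, hj⟩ : Fin k) (Submodule.mem_map_of_mem hm)

theorem powerSum_le_iff {k : ℕ} {P : Submodule F M} :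
    powerSum x N k ≤ P ↔ ∀ j < k, ∀ m ∈ N, (LieModule.toEnd F L M x ^ j) m ∈ P := by
  simp only [powerSum, iSup_le_iff, Submodule.map_le_iff_le_comap]
  exact ⟨fun h j hj m hm => h ⟨j, hj⟩ hm, fun h j m hm => h j j.2 m hm⟩

theorem powerSum_mono {k l : ℕ} (h : k ≤ l) : powerSum x N k ≤ powerSum x N l :=
  powerSum_le_iff.2 fun _ hj _ hm => pow_apply_mem_powerSum (hj.trans_le h) hm

theorem lie_mem_powerSum_succ {k : ℕ} {m : M} (hm : m ∈ powerSum x N k) :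
    ⁅x, m⁆ ∈ powerSum x N (k + 1) := by
  have h : powerSum x N k ≤ (powerSum x N (k + 1)).comap (LieModule.toEnd F L M x) :=
    powerSum_le_iff.2 fun j hj m hm => by
      have := pow_apply_mem_powerSum (x := x) (Nat.succ_lt_succ hj) hm
      rwa [pow_succ', Module.End.mul_apply] at this
  exact h hm

variable {H : LieSubalgebra F L}

/-- An `H`-stable subspace `N` satisfies `h x ^ k m = x ^ k h m` modulo
`N + x N + ⋯ + x ^ (k - 1) N`, when `H` contains all brackets. -/
theorem lie_pow_sub_mem_powerSum (hlie : ∀ a b : L, ⁅a, b⁆ ∈ H)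
    (hN : ∀ h ∈ H, ∀ m ∈ N, ⁅h, m⁆ ∈ N) (k : ℕ) (h : L) (hh : h ∈ H) (m : M) (hm : m ∈ N) :
    ⁅h, (LieModule.toEnd F L M x ^ k) m⁆ - (LieModule.toEnd F L M x ^ k) ⁅h, m⁆ ∈
      powerSum x N k := by
  induction k generalizing h with
  | zero => simp
  | succ k ih =>
    have h1 : ⁅⁅h, x⁆, (LieModule.toEnd F L M x ^ k) m⁆ ∈ powerSum x N (k + 1) := by
      have := add_mem (powerSum_mono k.le_succ (ih ⁅h, x⁆ (hlie h x)))
        (pow_apply_mem_powerSum (x := x) k.lt_succ_self (hN _ (hlie h x) m hm))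
      rwa [sub_add_cancel] at this
    have h2 := add_mem h1 (lie_mem_powerSum_succ (ih h hh))
    rw [pow_succ', Module.End.mul_apply, Module.End.mul_apply, LieModule.toEnd_apply_apply,
      LieModule.toEnd_apply_apply, leibniz_lie]
    rwa [lie_sub, ← add_sub_assoc] at h2

theorem lie_mem_powerSum (hlie : ∀ a b : L, ⁅a, b⁆ ∈ H)
    (hN : ∀ h ∈ H, ∀ m ∈ N, ⁅h, m⁆ ∈ N) {k : ℕ} {h : L} (hh : h ∈ H) {m : M} (hm : m ∈ powerSum x N k) :
    ⁅h, m⁆ ∈ powerSum x N k := by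
  have hle : powerSum x N k ≤ (powerSum x N k).comap (LieModule.toEnd F L M h) :=
    powerSum_le_iff.2 fun j hj m hm => by
      have := add_mem (powerSum_mono hj.le (lie_pow_sub_mem_powerSum (x := x) hlie hN j h hh m hm))
        (pow_apply_mem_powerSum (x := x) hj (hN h hh m hm))
      rwa [sub_add_cancel] at this
  exact hle hm

/-- If `M` has a `p`-character and `x^[p] ∈ H + F x`, then an `H`-stable subspace `N` generates the
`L`-submodule `N + x N + ⋯ + x ^ (p - 1) N`. -/
theorem exists_lieSubmodule_eq_powerSum {p : ℕ} [hp : Fact p.Prime] [RestrictedLieAlgebra p F L]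
    {χ : Module.Dual F L} (hM : HasPCharacter p χ M) (hlie : ∀ a b : L, ⁅a, b⁆ ∈ H)
    (hN : ∀ h ∈ H, ∀ m ∈ N, ⁅h, m⁆ ∈ N) {c : F} (hxc : pMap p F x - c • x ∈ H)
    (hspan : ∀ y : L, ∃ h ∈ H, ∃ a : F, y = h + a • x) :
    ∃ P : LieSubmodule F L M, P.toSubmodule = powerSum x N p := by
  have hx : powerSum x N p ≤ (powerSum x N p).comap (LieModule.toEnd F L M x) := by
    refine powerSum_le_iff.2 fun j hj m hm => ?_
    rw [Submodule.mem_comap, ← Module.End.mul_apply, ← pow_succ']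
    rcases Nat.lt_or_ge (j + 1) p with hj' | hj'
    · exact pow_apply_mem_powerSum hj' hm
    · have h0 : m ∈ powerSum x N p := by
        simpa using pow_apply_mem_powerSum (x := x) (j := 0) hp.out.pos hm
      have h1 : ⁅x, m⁆ ∈ powerSum x N p := by
        simpa using pow_apply_mem_powerSum (x := x) (j := 1) hp.out.one_lt hm
      rw [show j + 1 = p by omega, sub_eq_iff_eq_add.1 (hM x), LinearMap.add_apply,
        LinearMap.smul_apply, Module.End.one_apply, LieModule.toEnd_apply_apply,
        ← sub_add_cancel (pMap p F x) (c • x), add_lie, smul_lie]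
      exact add_mem (Submodule.smul_mem _ _ h0)
        (add_mem (lie_mem_powerSum hlie hN hxc h0) (Submodule.smul_mem _ _ h1))
  refine ⟨{ powerSum x N p with lie_mem := fun {y m} hm => ?_ }, rfl⟩
  obtain ⟨h, hh, a, rfl⟩ := hspan y
  rw [add_lie, smul_lie]
  exact add_mem (lie_mem_powerSum hlie hN hh hm) (Submodule.smul_mem _ _ (hx hm))

end PowerSum

section Restriction

variable {p : ℕ} {F : Type u} [Field F] {L : Type v} [LieRing L] [LieAlgebra F L]
  [RestrictedLieAlgebra p F L]

theorem HasPCharacter.restrict {χ : Module.Dual F L} {M : Type w} [AddCommGroup M] [Module F M]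
    [LieRingModule L M] [LieModule F L M] (hM : HasPCharacter p χ M) {H : LieSubalgebra F L}
    [RestrictedLieAlgebra p F H] (hH : ∀ x : H, ((pMap p F x : H) : L) = pMap p F (x : L)) :
    HasPCharacter p (χ ∘ₗ (H.incl : H →ₗ[F] L)) M := by
  intro y
  have h := hM y
  rw [← hH] at h
  exact h

theorem HasPCharacter.lieSubmodule {χ : Module.Dual F L} {M : Type w} [AddCommGroup M]
    [Module F M] [LieRingModule L M] [LieModule F L M] (hM : HasPCharacter p χ M)
    (N : LieSubmodule F L M) : HasPCharacter p χ N := by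
  intro y
  ext m
  have h := LinearMap.congr_fun (hM y) (m : M)
  have key (k : ℕ) : (((LieModule.toEnd F L N y ^ k) m : N) : M) =
      (LieModule.toEnd F L M y ^ k) (m : M) :=
    (LieModule.toEnd_pow_apply_map N.incl k y m).symm
  simpa [key] using h

end Restriction

/-- Modules with a `p`-character over a solvable restricted Lie algebra are locally finite. -/
theorem HasPCharacter.exists_finiteDimensional_ge {p : ℕ} [hp : Fact p.Prime] {F : Type u} [Field F]
    [CharP F p] [IsAlgClosed F] {L : Type v} [LieRing L] [LieAlgebra F L] [FiniteDimensional F L]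
    [RestrictedLieAlgebra p F L] [LieAlgebra.IsSolvable L] {χ : Module.Dual F L}
    {M : Type w} [AddCommGroup M] [Module F M] [LieRingModule L M] [LieModule F L M]
    (hM : HasPCharacter p χ M) (W : Submodule F M) [FiniteDimensional F W] :
    ∃ N : LieSubmodule F L M, W ≤ N.toSubmodule ∧ FiniteDimensional F N := by
  induction hn : Module.finrank F L using Nat.strong_induction_on generalizing L with
  | _ n ih =>
  subst hn
  cases subsingleton_or_nontrivial L with
  | inl _ =>
    refine ⟨{ W with lie_mem := fun {y m} _ => ?_ }, le_rfl, ‹_›⟩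
    rw [Subsingleton.elim y 0, zero_lie]
    exact W.zero_mem
  | inr _ =>
    obtain ⟨H, x, c, hlie, hpH, hx, hxc, hspan⟩ := exists_codim_one p F L
    let _ := ofLieSubalgebra p F H hpH
    have : LieAlgebra.IsSolvable H :=
      Function.Injective.lieAlgebra_isSolvable (f := H.incl) Subtype.val_injective
    have hlt : Module.finrank F H < Module.finrank F L :=
      Submodule.finrank_lt fun h => hx (by rw [← LieSubalgebra.mem_toSubmodule, h]; trivial)
    obtain ⟨N, hWN, hN⟩ := ih _ hlt (HasPCharacter.restrict (H := H) hM fun _ => rfl) rfl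
    obtain ⟨P, hP⟩ := exists_lieSubmodule_eq_powerSum (N := N.toSubmodule) (H := H) hM hlie
      (fun h hh m hm => N.lie_mem (x := ⟨h, hh⟩) hm) hxc hspan
    refine ⟨P, ?_, ?_⟩
    · rw [hP]
      intro m hm
      simpa using pow_apply_mem_powerSum (x := x) (j := 0) hp.out.pos (hWN hm)
    · have : FiniteDimensional F N.toSubmodule := hN
      change FiniteDimensional F P.toSubmodule
      rw [hP]
      unfold powerSum
      infer_instance

section Irreducible

variable {p : ℕ} [hp : Fact p.Prime] {F : Type u} [Field F]
    [CharP F p] [IsAlgClosed F] {L : Type v} [LieRing L] [LieAlgebra F L] [FiniteDimensional F L]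
    [RestrictedLieAlgebra p F L] [LieAlgebra.IsSolvable L] {χ : Module.Dual F L}

theorem HasPCharacter.finiteDimensional_of_isIrreducible
    {M : Type w} [AddCommGroup M] [Module F M] [LieRingModule L M] [LieModule F L M]
    (hM : HasPCharacter p χ M) (hirr : LieModule.IsIrreducible F L M) :
    FiniteDimensional F M := by
  have : Nontrivial M := (LieSubmodule.nontrivial_iff F L M).1 hirr.toNontrivial
  obtain ⟨m, hm⟩ := exists_ne (0 : M)
  obtain ⟨N, hmN, hN⟩ := hM.exists_finiteDimensional_ge (F ∙ m)
  have hmN' : m ∈ N := hmN (Submodule.mem_span_singleton_self m)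
  have htop : N = ⊤ := by
    refine (hirr.eq_bot_or_eq_top N).resolve_left fun h => hm ?_
    rwa [h, LieSubmodule.mem_bot] at hmN'
  have h : FiniteDimensional F N.toSubmodule := hN
  rw [htop] at h
  exact Module.Finite.equiv (Submodule.topEquiv (R := F) (M := M))

/-- The restriction of an irreducible module to a restricted subalgebra has an irreducible
submodule. -/
theorem IrreducibleModule.exists_injective_restrict (M : IrreducibleModule.{u, v, w} p χ)
    {H : LieSubalgebra F L} [RestrictedLieAlgebra p F H]
    (hH : ∀ x : H, ((pMap p F x : H) : L) = pMap p F (x : L)) :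
    ∃ (V : IrreducibleModule.{u, v, w} p (χ ∘ₗ (H.incl : H →ₗ[F] L)))
      (ι : V.carrier →ₗ⁅F, H⁆ M.carrier), Function.Injective ι := by
  have hfin := M.hasPCharacter.finiteDimensional_of_isIrreducible M.irreducible
  have hnt : Nontrivial M.carrier :=
    (LieSubmodule.nontrivial_iff F L M.carrier).1 M.irreducible.toNontrivial
  obtain ⟨V, hV, -⟩ := (eq_bot_or_exists_atom_le (⊤ : LieSubmodule F H M.carrier)).resolve_left
    top_ne_bot
  have hVnt : Nontrivial V := (LieSubmodule.nontrivial_iff_ne_bot F H M.carrier).2 hV.1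
  have hirr : LieModule.IsIrreducible F H V := by
    refine LieModule.IsIrreducible.mk fun N hN => ?_
    have h1 : N.map V.incl ≤ V := LieSubmodule.map_incl_le
    rcases hV.le_iff.1 h1 with h | h
    · refine absurd ?_ hN
      rw [eq_bot_iff]
      intro m hm
      have : V.incl m ∈ N.map V.incl := LieSubmodule.mem_map_of_mem hm
      rw [h, LieSubmodule.mem_bot] at this
      rw [LieSubmodule.mem_bot]
      exact Subtype.ext this
    · rw [eq_top_iff]
      rintro ⟨m, hm⟩ -
      rw [← h] at hm
      obtain ⟨m', hm', he⟩ := (LieSubmodule.mem_map _).1 hm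
      have : m' = ⟨m, by rwa [h] at hm⟩ := Subtype.ext he
      rwa [← this]
  exact ⟨⟨V, hirr, (M.hasPCharacter.restrict hH).lieSubmodule V⟩, V.incl, Subtype.val_injective⟩

end Irreducible

end RestrictedLieAlgebra

/-! ### Twisted homomorphisms -/

namespace RestrictedLieAlgebra

section Twisted

variable {F : Type u} [Field F] {L : Type v} [LieRing L] [LieAlgebra F L]
  {M N : Type w} [AddCommGroup M] [Module F M] [LieRingModule L M] [LieModule F L M]
  [AddCommGroup N] [Module F N] [LieRingModule L N] [LieModule F L N]

/-- `f` is a homomorphism of `L`-modules from the twist of `M` by the character of `L = H + F x`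
that vanishes on `H` and takes the value `r` at `x`. -/
structure IsTwistedHom (H : LieSubalgebra F L) (x : L) (r : F) (f : M →ₗ[F] N) : Prop where
  map_lie : ∀ h ∈ H, ∀ m : M, f ⁅h, m⁆ = ⁅h, f m⁆
  lie_map : ∀ m : M, ⁅x, f m⁆ = f ⁅x, m⁆ + r • f m

variable {H : LieSubalgebra F L} {x : L} {r : F} {f : M →ₗ[F] N}

theorem IsTwistedHom.map_lie_eq (hf : IsTwistedHom H x r f) {h : L} (hh : h ∈ H) (a : F) (m : M) :
    f ⁅h + a • x, m⁆ = ⁅h + a • x, f m⁆ - (a * r) • f m := by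
  simp only [add_lie, smul_lie, map_add, map_smul, hf.map_lie h hh, hf.lie_map, smul_add, smul_smul]
  abel

/-- Schur's lemma for twisted homomorphisms. -/
theorem IsTwistedHom.bijective (hf : IsTwistedHom H x r f) (hf0 : f ≠ 0)
    (hM : LieModule.IsIrreducible F L M) (hN : LieModule.IsIrreducible F L N)
    (hspan : ∀ y : L, ∃ h ∈ H, ∃ a : F, y = h + a • x) : Function.Bijective f := by
  obtain ⟨m₀, hm₀⟩ : ∃ m, f m ≠ 0 := by
    by_contra! h
    exact hf0 (LinearMap.ext h)
  let K : LieSubmodule F L M :=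
    { LinearMap.ker f with
      lie_mem := fun {y m} hm => by
        obtain ⟨h, hh, a, rfl⟩ := hspan y
        have hm' : f m = 0 := hm
        change f _ = 0
        rw [hf.map_lie_eq hh, hm', lie_zero, smul_zero, sub_zero] }
  let R : LieSubmodule F L N :=
    { LinearMap.range f with
      lie_mem := fun {y n} hn => by
        obtain ⟨h, hh, a, rfl⟩ := hspan y
        obtain ⟨m, rfl⟩ := hn
        refine ⟨⁅h + a • x, m⁆ + (a * r) • m, ?_⟩
        rw [map_add, hf.map_lie_eq hh, map_smul, sub_add_cancel] }
  have hK : K = ⊥ := (hM.eq_bot_or_eq_top K).resolve_right fun h => hm₀ <| by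
    have : m₀ ∈ K := by rw [h]; exact LieSubmodule.mem_top m₀
    exact this
  have hR : R = ⊤ := (hN.eq_bot_or_eq_top R).resolve_left fun h => hm₀ <| by
    have : f m₀ ∈ R := ⟨m₀, rfl⟩
    rwa [h, LieSubmodule.mem_bot] at this
  refine ⟨(injective_iff_map_eq_zero f).2 fun m hm => ?_, fun n => ?_⟩
  · have : m ∈ K := hm
    rwa [hK, LieSubmodule.mem_bot] at this
  · have : n ∈ R := by rw [hR]; exact LieSubmodule.mem_top n
    exact this

/-- Two modules that are isomorphic to the same module up to the same twist are isomorphic. -/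
theorem IsTwistedHom.nonempty_equiv {M' : Type w} [AddCommGroup M'] [Module F M']
    [LieRingModule L M'] [LieModule F L M'] {f' : M' →ₗ[F] N} (hf : IsTwistedHom H x r f)
    (hf' : IsTwistedHom H x r f') (hb : Function.Bijective f) (hb' : Function.Bijective f')
    (hspan : ∀ y : L, ∃ h ∈ H, ∃ a : F, y = h + a • x) : Nonempty (M ≃ₗ⁅F, L⁆ M') := by
  let e := (LinearEquiv.ofBijective f hb).trans (LinearEquiv.ofBijective f' hb').symm
  have he (m : M) : f' (e m) = f m := (LinearEquiv.ofBijective f' hb').apply_symm_apply (f m)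
  refine ⟨{ e with map_lie' := fun {y m} => hb'.1 ?_ }⟩
  change f' (e ⁅y, m⁆) = f' ⁅y, e m⁆
  obtain ⟨h, hh, a, rfl⟩ := hspan y
  rw [he, hf.map_lie_eq hh, hf'.map_lie_eq hh, he]

variable {p : ℕ} [hp : Fact p.Prime] [RestrictedLieAlgebra p F L] {χ : Module.Dual F L}

/-- The value at `x` of the twisting character is constrained by the `p`-characters: compare the
actions of `x ^ p` on both sides. -/
theorem IsTwistedHom.pow_eq [CharP F p] (hM : HasPCharacter p χ M) (hN : HasPCharacter p χ N)
    (hf : IsTwistedHom H x r f) (hf0 : f ≠ 0) {c : F} (hxc : pMap p F x - c • x ∈ H) :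
    r ^ p = c * r := by
  obtain ⟨m, hm⟩ : ∃ m, f m ≠ 0 := by
    by_contra! h
    exact hf0 (LinearMap.ext h)
  have : Nontrivial M := ⟨m, 0, fun h => hm (by rw [h, map_zero])⟩
  have : CharP (Module.End F M) p :=
    charP_of_injective_algebraMap (algebraMap F (Module.End F M)).injective p
  have hpow (k : ℕ) : (LieModule.toEnd F L N x ^ k) (f m) =
      f (((LieModule.toEnd F L M x + algebraMap F _ r) ^ k) m) := by
    induction k with
    | zero => simp
    | succ k ih =>
      rw [pow_succ', Module.End.mul_apply, ih, LieModule.toEnd_apply_apply, hf.lie_map, ← map_smul,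
        ← map_add, pow_succ', Module.End.mul_apply, LinearMap.add_apply,
        LieModule.toEnd_apply_apply, Module.algebraMap_end_apply]
  have h1 := hpow p
  rw [add_pow_char_of_commute p (Algebra.commutes r _).symm, sub_eq_iff_eq_add.1 (hM x),
    sub_eq_iff_eq_add.1 (hN x), ← map_pow (algebraMap F (Module.End F M))] at h1
  simp only [LinearMap.add_apply, LinearMap.smul_apply, Module.End.one_apply,
    LieModule.toEnd_apply_apply, Module.algebraMap_end_apply, map_add, map_smul] at h1
  have h2 : f ⁅pMap p F x, m⁆ = ⁅pMap p F x, f m⁆ - (c * r) • f m := by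
    have := hf.map_lie_eq hxc c m
    rwa [sub_add_cancel] at this
  rw [h2] at h1
  have h3 : (r ^ p - c * r) • f m = 0 := by
    rw [sub_smul, sub_eq_zero]
    have h4 := sub_eq_zero.2 h1
    rw [← sub_eq_zero, ← neg_eq_zero, ← h4]
    abel
  exact sub_eq_zero.1 ((smul_eq_zero.1 h3).resolve_right hm)

/-- The space of `H`-homomorphisms, if it is nonzero, contains a twisted `L`-homomorphism: an
eigenvector of `x`. -/
theorem exists_isTwistedHom [IsAlgClosed F] [FiniteDimensional F M] [FiniteDimensional F N]
    (hlie : ∀ a b : L, ⁅a, b⁆ ∈ H) (f : M →ₗ[F] N) (hf0 : f ≠ 0)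
    (hf : ∀ h ∈ H, ∀ m : M, f ⁅h, m⁆ = ⁅h, f m⁆) (x : L) :
    ∃ (r : F) (g : M →ₗ[F] N), g ≠ 0 ∧ IsTwistedHom H x r g := by
  let W : Submodule F (M →ₗ[F] N) :=
    { carrier := {g | ∀ h ∈ H, ⁅h, g⁆ = 0}
      zero_mem' := fun h _ => lie_zero h
      add_mem' := fun ha hb h hh => by rw [lie_add, ha h hh, hb h hh, add_zero]
      smul_mem' := fun c a ha h hh => by rw [lie_smul, ha h hh, smul_zero] }
  have hW : ∀ g ∈ W, LieModule.toEnd F L (M →ₗ[F] N) x g ∈ W := fun g hg h hh => by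
    rw [LieModule.toEnd_apply_apply, leibniz_lie, hg h hh, lie_zero, hg _ (hlie h x), add_zero]
  have hfW : f ∈ W := fun h hh => LinearMap.ext fun m => by
    rw [LieHom.lie_apply, hf h hh, sub_self, LinearMap.zero_apply]
  have : Nontrivial W := ⟨⟨f, hfW⟩, 0, fun h => hf0 (congrArg Subtype.val h)⟩
  obtain ⟨r, hr⟩ := Module.End.exists_eigenvalue ((LieModule.toEnd F L (M →ₗ[F] N) x).restrict hW)
  obtain ⟨g, hg⟩ := hr.exists_hasEigenvector
  have hgx : ⁅x, (g : M →ₗ[F] N)⁆ = r • (g : M →ₗ[F] N) := congrArg Subtype.val hg.apply_eq_smul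
  refine ⟨r, g, fun h => hg.2 (Subtype.ext h), fun h hh m => ?_, fun m => ?_⟩
  · have := LinearMap.congr_fun (g.2 h hh) m
    rw [LieHom.lie_apply, LinearMap.zero_apply, sub_eq_zero] at this
    exact this.symm
  · have := LinearMap.congr_fun hgx m
    rwa [LieHom.lie_apply, LinearMap.smul_apply, sub_eq_iff_eq_add'] at this

/-- Let `V` be an irreducible `H`-submodule of an irreducible `L`-module `M`. Then `M` has `V` also
as a quotient over `H`: for a maximal `H`-submodule `Q` of `M` and the least `k` with
`x ^ k V ⊈ Q`, the map `v ↦ x ^ k v` from `V` to `M / Q` is an isomorphism. -/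
theorem exists_restrict_hom [FiniteDimensional F M] (hM : HasPCharacter p χ M)
    (hirr : LieModule.IsIrreducible F L M) (hlie : ∀ a b : L, ⁅a, b⁆ ∈ H) {c : F}
    (hxc : pMap p F x - c • x ∈ H) (hspan : ∀ y : L, ∃ h ∈ H, ∃ a : F, y = h + a • x)
    {V : Type w} [AddCommGroup V] [Module F V] [LieRingModule H V] [LieModule F H V]
    (hV : LieModule.IsIrreducible F H V) (ι : V →ₗ⁅F, H⁆ M) (hι : Function.Injective ι) :
    ∃ g : M →ₗ⁅F, H⁆ V, g ≠ 0 := by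
  classical
  have hMnt : Nontrivial M := (LieSubmodule.nontrivial_iff F L M).1 hirr.toNontrivial
  have hVnt : Nontrivial V := (LieSubmodule.nontrivial_iff F H V).1 hV.toNontrivial
  obtain ⟨Q, hQ⟩ := exists_maximal_of_wellFoundedGT (fun P : LieSubmodule F H M => P ≠ ⊤)
    ⟨⊥, bot_ne_top⟩
  have hιH : ∀ h ∈ H, ∀ m ∈ (ι.range : Submodule F M), ⁅h, m⁆ ∈ (ι.range : Submodule F M) :=
    fun h hh m hm => ι.range.lie_mem (x := ⟨h, hh⟩) hm
  have hex : ∃ k, ∃ v : V, (LieModule.toEnd F L M x ^ k) (ι v) ∉ Q := by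
    by_contra! hcon
    obtain ⟨P, hP⟩ := exists_lieSubmodule_eq_powerSum (x := x) hM hlie hιH hxc hspan
    have hPQ : P.toSubmodule ≤ Q.toSubmodule := by
      rw [hP]
      refine powerSum_le_iff.2 fun j _ m hm => ?_
      obtain ⟨v, rfl⟩ := (LieModuleHom.mem_range ι m).1 hm
      exact hcon j v
    rcases hirr.eq_bot_or_eq_top P with h | h
    · obtain ⟨v, hv⟩ := exists_ne (0 : V)
      have hmem : ι v ∈ P.toSubmodule := by
        rw [hP]
        simpa using pow_apply_mem_powerSum (x := x) (j := 0) hp.out.pos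
          (show ι v ∈ (ι.range : Submodule F M) from ⟨v, rfl⟩)
      rw [h] at hmem
      have h0 : ι v = 0 := hmem
      exact hv (hι (h0.trans (map_zero ι).symm))
    · refine hQ.1 (eq_top_iff.2 fun m _ => hPQ ?_)
      rw [h]
      exact Submodule.mem_top
  let k := Nat.find hex
  obtain ⟨v₀, hv₀⟩ := Nat.find_spec hex
  have hlow : powerSum x (ι.range : Submodule F M) k ≤ Q.toSubmodule := by
    refine powerSum_le_iff.2 fun j hj m hm => ?_
    obtain ⟨v, rfl⟩ := (LieModuleHom.mem_range ι m).1 hm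
    by_contra hcon
    exact Nat.find_min hex hj ⟨v, hcon⟩
  let π : M →ₗ⁅F, H⁆ M ⧸ Q := LieSubmodule.Quotient.mk' Q
  have hπ (m : M) : π m = 0 ↔ m ∈ Q := LieSubmodule.Quotient.mk_eq_zero'
  let φ : V →ₗ⁅F, H⁆ M ⧸ Q :=
    { (π : M →ₗ[F] M ⧸ Q) ∘ₗ (LieModule.toEnd F L M x ^ k) ∘ₗ (ι : V →ₗ[F] M) with
      map_lie' := fun {h v} => by
        have h1 := hlow (lie_pow_sub_mem_powerSum hlie hιH k h h.2 (ι v) ⟨v, rfl⟩)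
        have h2 := (hπ _).2 h1
        rw [map_sub, sub_eq_zero] at h2
        change π ((LieModule.toEnd F L M x ^ k) (ι ⁅h, v⁆)) =
          ⁅h, π ((LieModule.toEnd F L M x ^ k) (ι v))⁆
        rw [← LieModuleHom.map_lie π, LieModuleHom.map_lie ι]
        exact h2.symm }
  have hφv₀ : φ v₀ ≠ 0 := fun h => hv₀ ((hπ _).1 h)
  have hker : φ.ker = ⊥ := (hV.eq_bot_or_eq_top φ.ker).resolve_right fun h => hφv₀ <| by
    have : v₀ ∈ φ.ker := by rw [h]; exact LieSubmodule.mem_top v₀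
    exact (LieModuleHom.mem_ker).1 this
  have hinj : Function.Injective φ := (injective_iff_map_eq_zero φ).2 fun v hv => by
    have : v ∈ φ.ker := (LieModuleHom.mem_ker).2 hv
    rwa [hker, LieSubmodule.mem_bot] at this
  have hsurj : Function.Surjective φ := by
    have htop : φ.range.comap π = ⊤ := by
      by_contra hcon
      have hle : Q ≤ φ.range.comap π := fun m hm => by
        rw [LieSubmodule.mem_comap, (hπ m).2 hm]
        exact φ.range.zero_mem
      have := hQ.2 hcon hle (show (LieModule.toEnd F L M x ^ k) (ι v₀) ∈ φ.range.comap π from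
        (LieSubmodule.mem_comap).2 ((LieModuleHom.mem_range φ _).2 ⟨v₀, rfl⟩))
      exact hv₀ this
    intro q
    obtain ⟨m, rfl⟩ := LieSubmodule.Quotient.surjective_mk' Q q
    have hm : m ∈ φ.range.comap π := by rw [htop]; exact LieSubmodule.mem_top m
    exact (LieModuleHom.mem_range φ _).1 (LieSubmodule.mem_comap.1 hm)
  let e := LinearEquiv.ofBijective (φ : V →ₗ[F] M ⧸ Q) ⟨hinj, hsurj⟩
  have he (q : M ⧸ Q) : φ (e.symm q) = q := e.apply_symm_apply q
  refine ⟨{ (e.symm : (M ⧸ Q) →ₗ[F] V) ∘ₗ (π : M →ₗ[F] M ⧸ Q) with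
    map_lie' := fun {h m} => hinj ?_ }, fun h0 => ?_⟩
  · change φ (e.symm (π ⁅h, m⁆)) = φ ⁅h, e.symm (π m)⁆
    rw [he, LieModuleHom.map_lie, LieModuleHom.map_lie, he]
  · obtain ⟨m, hm⟩ := LieSubmodule.Quotient.surjective_mk' Q (φ v₀)
    have h1 : e.symm (π m) = 0 := LieModuleHom.congr_fun h0 m
    refine hφv₀ ?_
    rw [← hm]
    change π m = 0
    rw [← he (π m), h1, map_zero]

end Twisted

/-! ### The number of irreducible modules -/

theorem finite_and_card_pow_eq_mul_le {p : ℕ} [hp : Fact p.Prime] {F : Type u} [Field F] (c : F) :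
    Finite {r : F // r ^ p = c * r} ∧ Nat.card {r : F // r ^ p = c * r} ≤ p := by
  classical
  let P : Polynomial F := Polynomial.X ^ p - Polynomial.C c * Polynomial.X
  have hlt : (Polynomial.C c * Polynomial.X : Polynomial F).degree < p :=
    (Polynomial.degree_C_mul_X_le c).trans_lt (by exact_mod_cast hp.out.one_lt)
  have hP : P.Monic := Polynomial.monic_X_pow_sub hlt
  have hdeg : P.natDegree = p := Polynomial.natDegree_eq_of_degree_eq_some <| by
    rw [Polynomial.degree_sub_eq_left_of_degree_lt (by rwa [Polynomial.degree_X_pow]),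
      Polynomial.degree_X_pow]
  let g : {r : F // r ^ p = c * r} → P.roots.toFinset := fun r => ⟨r, by
    rw [Multiset.mem_toFinset, Polynomial.mem_roots hP.ne_zero]
    simp [P, r.2]⟩
  have hg : Function.Injective g := fun r s h => Subtype.ext (congrArg (fun z : P.roots.toFinset => (z : F)) h)
  refine ⟨Finite.of_injective g hg, (Nat.card_le_card_of_injective g hg).trans ?_⟩
  rw [Nat.card_eq_fintype_card, Fintype.card_coe]
  exact (Multiset.toFinset_card_le _).trans ((Polynomial.card_roots' P).trans hdeg.le)

/-- Over the zero Lie algebra every irreducible module is one-dimensional. -/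
theorem subsingleton_irr {p : ℕ} {F : Type u} [Field F] {L : Type v} [LieRing L] [LieAlgebra F L]
    [RestrictedLieAlgebra p F L] [Subsingleton L] (χ : Module.Dual F L) : Subsingleton (Irr.{u, v, w} p χ) := by
  have hlie (M : IrreducibleModule.{u, v, w} p χ) (y : L) (m : M.carrier) : ⁅y, m⁆ = 0 := by
    rw [Subsingleton.elim y 0, zero_lie]
  have h1 (M : IrreducibleModule.{u, v, w} p χ) : Module.finrank F M.carrier = 1 := by
    have : Nontrivial M.carrier :=
      (LieSubmodule.nontrivial_iff F L M.carrier).1 M.irreducible.toNontrivial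
    obtain ⟨m, hm⟩ := exists_ne (0 : M.carrier)
    let N : LieSubmodule F L M.carrier :=
      { F ∙ m with lie_mem := fun {y n} _ => by rw [hlie]; exact Submodule.zero_mem _ }
    have hmN : m ∈ N := Submodule.mem_span_singleton_self m
    have hN : N = ⊤ := (M.irreducible.eq_bot_or_eq_top N).resolve_left fun h => hm <| by
      rwa [h, LieSubmodule.mem_bot] at hmN
    refine finrank_eq_one m hm fun n => ?_
    have hn : n ∈ N := by rw [hN]; exact LieSubmodule.mem_top n
    exact Submodule.mem_span_singleton.1 hn
  refine ⟨fun s t => ?_⟩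
  induction s using Quotient.inductionOn with | _ M =>
  induction t using Quotient.inductionOn with | _ N =>
  have := Module.finite_of_finrank_eq_succ (h1 M)
  have := Module.finite_of_finrank_eq_succ (h1 N)
  let e := LinearEquiv.ofFinrankEq M.carrier N.carrier ((h1 M).trans (h1 N).symm)
  refine Quotient.sound ⟨{ e with map_lie' := fun {y m} => ?_ }⟩
  change e ⁅y, m⁆ = ⁅y, e m⁆
  rw [hlie, hlie, map_zero]

section Count

variable {p : ℕ} [hp : Fact p.Prime] {F : Type u} [Field F] [CharP F p] [IsAlgClosed F]

/-- Irreducible `L`-modules that have isomorphic irreducible `H`-submodules are isomorphic up to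
a twist by one of the solutions of `r ^ p = c * r`. -/
theorem IrreducibleModule.exists_isTwistedHom {L : Type v} [LieRing L] [LieAlgebra F L]
    [FiniteDimensional F L] [RestrictedLieAlgebra p F L] [LieAlgebra.IsSolvable L]
    {χ : Module.Dual F L} {H : LieSubalgebra F L} {x : L} {c : F}
    (hlie : ∀ a b : L, ⁅a, b⁆ ∈ H) (hxc : pMap p F x - c • x ∈ H)
    (hspan : ∀ y : L, ∃ h ∈ H, ∃ a : F, y = h + a • x)
    (M N : IrreducibleModule.{u, v, w} p χ)
    {V W : Type w} [AddCommGroup V] [Module F V] [LieRingModule H V] [LieModule F H V]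
    [AddCommGroup W] [Module F W] [LieRingModule H W] [LieModule F H W]
    (hV : LieModule.IsIrreducible F H V) (ι : V →ₗ⁅F, H⁆ M.carrier) (hι : Function.Injective ι)
    (κ : W →ₗ⁅F, H⁆ N.carrier) (hκ : Function.Injective κ) (e : V ≃ₗ⁅F, H⁆ W) :
    ∃ (r : F) (f : M.carrier →ₗ[F] N.carrier),
      r ^ p = c * r ∧ Function.Bijective f ∧ IsTwistedHom H x r f := by
  have := M.hasPCharacter.finiteDimensional_of_isIrreducible M.irreducible
  have := N.hasPCharacter.finiteDimensional_of_isIrreducible N.irreducible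
  obtain ⟨g, hg⟩ := exists_restrict_hom M.hasPCharacter M.irreducible hlie hxc hspan hV ι hι
  let f : M.carrier →ₗ⁅F, H⁆ N.carrier := κ.comp ((e : V →ₗ⁅F, H⁆ W).comp g)
  have hf (m : M.carrier) : f m = κ (e (g m)) := rfl
  have hf0 : (f : M.carrier →ₗ[F] N.carrier) ≠ 0 := fun h => hg <| by
    ext m
    have h1 : κ (e (g m)) = 0 := LinearMap.congr_fun h m
    have h2 : e (g m) = 0 := hκ (h1.trans (map_zero κ).symm)
    exact e.injective (h2.trans (map_zero (e : V →ₗ⁅F, H⁆ W)).symm)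
  obtain ⟨r, f', hf'0, hf'⟩ := RestrictedLieAlgebra.exists_isTwistedHom hlie
    (f : M.carrier →ₗ[F] N.carrier) hf0 (fun h hh m => f.map_lie ⟨h, hh⟩ m) x
  exact ⟨r, f', hf'.pow_eq M.hasPCharacter N.hasPCharacter hf'0 hxc,
    hf'.bijective hf'0 M.irreducible N.irreducible hspan, hf'⟩

/-- If elements in the same fibre of `π : A → B` are related by some `c : C`, and `c` together with
one of two related elements determines the other, then `A` embeds into `B × C`. -/
theorem exists_injective_prod {A B C : Type*} (π : A → B) (R : A → A → C → Prop)
    (hex : ∀ a b, π a = π b → ∃ c, R a b c) (huniq : ∀ a a' b c, R a b c → R a' b c → a = a') :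
    ∃ g : A → B × C, Function.Injective g := by
  cases isEmpty_or_nonempty A with
  | inl _ => exact ⟨isEmptyElim, isEmptyElim⟩
  | inr _ =>
    have h (a : A) : ∃ c, R a (Function.invFun π (π a)) c :=
      hex _ _ (Function.invFun_eq ⟨a, rfl⟩).symm
    choose γ hγ using h
    refine ⟨fun a => (π a, γ a), fun a a' haa' => ?_⟩
    obtain ⟨h1, h2⟩ := Prod.mk.inj haa'
    refine huniq a a' _ (γ a) (hγ a) ?_
    rw [h1, h2]
    exact hγ a'

/-- The isomorphism classes over `L = H + F x` embed into the product of those over `H` and the set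
of twists. -/
theorem exists_injective_irr {L : Type v} [LieRing L] [LieAlgebra F L]
    [FiniteDimensional F L] [RestrictedLieAlgebra p F L] [LieAlgebra.IsSolvable L]
    (χ : Module.Dual F L) {H : LieSubalgebra F L} [RestrictedLieAlgebra p F H]
    (hH : ∀ x : H, ((pMap p F x : H) : L) = pMap p F (x : L)) {x : L} {c : F}
    (hlie : ∀ a b : L, ⁅a, b⁆ ∈ H) (hxc : pMap p F x - c • x ∈ H)
    (hspan : ∀ y : L, ∃ h ∈ H, ∃ a : F, y = h + a • x) :
    ∃ g : Irr.{u, v, w} p χ →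
      Irr.{u, v, w} p (χ ∘ₗ (H.incl : H →ₗ[F] L)) × {r : F // r ^ p = c * r},
      Function.Injective g := by
  choose V ι hι using fun M : IrreducibleModule.{u, v, w} p χ => M.exists_injective_restrict hH
  refine exists_injective_prod
    (fun s => Quotient.mk (IrreducibleModule.isoSetoid p _) (V s.out))
    (fun s t r => ∃ f : s.out.carrier →ₗ[F] t.out.carrier,
      Function.Bijective f ∧ IsTwistedHom H x (r : F) f) ?_ ?_
  · intro s t hst
    obtain ⟨e⟩ := Quotient.exact hst
    obtain ⟨r, f, hr, hf⟩ := IrreducibleModule.exists_isTwistedHom hlie hxc hspan s.out t.out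
      (V s.out).irreducible (ι s.out) (hι s.out) (ι t.out) (hι t.out) e
    exact ⟨⟨r, hr⟩, f, hf⟩
  · rintro s s' t r ⟨f, hb, hf⟩ ⟨f', hb', hf'⟩
    rw [← Quotient.out_eq s, ← Quotient.out_eq s']
    exact Quotient.sound (hf.nonempty_equiv hf' hb hb' hspan)

/-- Descending from `L` to `H` in `L = H + F x` costs a factor `p` only if the `p`-map has a
nonzero eigenvalue `c` modulo `H`, and then a torus of `H` can be enlarged. -/
theorem exists_isTorus_card_irr_le {L : Type v} [LieRing L] [LieAlgebra F L]
    [FiniteDimensional F L] [RestrictedLieAlgebra p F L] [LieAlgebra.IsSolvable L]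
    (χ : Module.Dual F L) :
    ∃ T : LieSubalgebra F L, IsTorus p F T ∧ Finite (Irr.{u, v, w} p χ) ∧
      Nat.card (Irr.{u, v, w} p χ) ≤ p ^ Module.finrank F T := by
  induction hn : Module.finrank F L using Nat.strong_induction_on generalizing L with
  | _ n ih =>
  subst hn
  cases subsingleton_or_nontrivial L with
  | inl _ =>
    have := subsingleton_irr.{u, v, w} (p := p) χ
    refine ⟨⊥, ⟨fun x _ => ?_, fun x _ y _ => Subsingleton.elim _ _, fun x _ => ?_⟩, inferInstance,
      (Finite.card_le_one_iff_subsingleton.2 this).trans (Nat.one_le_pow _ _ hp.out.pos)⟩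
    · rw [Subsingleton.elim (pMap p F x) 0]; exact zero_mem _
    · unfold IsSemisimpleElement
      rw [Subsingleton.elim x 0]; exact zero_mem _
  | inr _ =>
    obtain ⟨H, x, c, hlie, hpH, hx, hxc, hspan⟩ := exists_codim_one p F L
    let _ := ofLieSubalgebra p F H hpH
    have : LieAlgebra.IsSolvable H :=
      Function.Injective.lieAlgebra_isSolvable (f := H.incl) Subtype.val_injective
    have hlt : Module.finrank F H < Module.finrank F L :=
      Submodule.finrank_lt fun h => hx (by rw [← LieSubalgebra.mem_toSubmodule, h]; trivial)
    obtain ⟨T, hT, hfin, hcard⟩ := ih _ hlt (χ ∘ₗ (H.incl : H →ₗ[F] L)) rfl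
    obtain ⟨g, hg⟩ := exists_injective_irr.{u, v, w} χ (H := H) (fun _ => rfl) hlie hxc hspan
    obtain ⟨hCfin, hCcard⟩ := finite_and_card_pow_eq_mul_le (p := p) c
    have hfinL : Finite (Irr.{u, v, w} p χ) := Finite.of_injective g hg
    have hle := Nat.card_le_card_of_injective g hg
    rw [Nat.card_prod] at hle
    have hT' : IsTorus p F (T.map H.incl) := hT.map_incl p F fun _ => rfl
    have hrank : Module.finrank F (T.map H.incl) = Module.finrank F T :=
      (Submodule.equivMapOfInjective (H.incl : H →ₗ[F] L) Subtype.val_injective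
        T.toSubmodule).finrank_eq.symm
    have hTH : T.map H.incl ≤ H := by rintro _ ⟨y, _, rfl⟩; exact y.2
    by_cases hc : c = 0
    · have hone : Nat.card {r : F // r ^ p = c * r} ≤ 1 := by
        rw [Finite.card_le_one_iff_subsingleton]
        have h0 (r : {r : F // r ^ p = c * r}) : (r : F) = 0 :=
          pow_eq_zero_iff hp.out.ne_zero |>.1 (r.2.trans (by rw [mul_eq_zero]; exact Or.inl hc))
        exact ⟨fun r s => Subtype.ext ((h0 r).trans (h0 s).symm)⟩
      refine ⟨_, hT', hfinL, hle.trans ?_⟩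
      rw [hrank]
      exact (Nat.mul_le_mul hcard hone).trans (mul_one _).le
    · obtain ⟨T', hT', hlt'⟩ := hT'.exists_finrank_lt p F hTH hlie hpH hx hc hxc
      refine ⟨T', hT', hfinL, hle.trans ((Nat.mul_le_mul hcard hCcard).trans ?_)⟩
      rw [← pow_succ]
      exact Nat.pow_le_pow_right hp.out.pos (by omega)

end Count

end RestrictedLieAlgebra

theorem mainTheorem3 (p : ℕ) [Fact p.Prime] (F : Type u) [Field F] [CharP F p] [IsAlgClosed F]
    (L : Type v) [LieRing L] [LieAlgebra F L] [FiniteDimensional F L]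
    [RestrictedLieAlgebra p F L] [LieAlgebra.IsSolvable L] (χ : Module.Dual F L) :
    Finite (RestrictedLieAlgebra.Irr.{u, v, w} p χ) ∧
      Nat.card (RestrictedLieAlgebra.Irr.{u, v, w} p χ) ≤
        p ^ RestrictedLieAlgebra.maxTorusDim p F L := by
  obtain ⟨T, hT, hfin, hcard⟩ := RestrictedLieAlgebra.exists_isTorus_card_irr_le.{u, v, w} χ
  exact ⟨hfin, hcard.trans
    (Nat.pow_le_pow_right (Fact.out : p.Prime).pos (hT.finrank_le_maxTorusDim p F))⟩
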